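/- For $v=(v_1,v_2)\in\mathbb R^2$ put $v^\perp=(-v_2,v_1)$. Norms on vectors are Euclidean, norms of matrices are the corresponding operator norms. Let $E:[0,\infty)\times\mathbb R^2\to\mathbb R^2$; Sobolev spaces $W^{k,\infty}$ and $L^\infty$ norms are taken over $(0,\infty)\times\mathbb R^2$ (in time and space), elements of $W^{k,\infty}$, $k\ge1$, are identified with their continuous representatives on $[0,\infty)\times\mathbb R^2$, and $K_x:=\|D_xE\|_{L^\infty}$. For $\varepsilon>0$ and $(x^0,v^0)\in\mathbb R^2\times\mathbb R^2$ let $(x_\varepsilon,v_\varepsilon)$ be the solution on $[0,\infty)$ of $$\varepsilon x_\varepsilon'(t)=v_\varepsilon(t),\qquad \varepsilon v_\varepsilon'(t)=E(t,x_\varepsilon(t))-\frac{v_\varepsilon^\perp(t)}{\varepsilon},\qquad x_\varepsilon(0)=x^0,\quad v_\varepsilon(0)=v^0.$$ For $\Delta t>0$ and $t_n=n\Delta t$ consider the first-order scheme (implicit in the velocity, explicit in $E$), for $n\ge0$, $$\frac{x_\varepsilon^{n+1}-x_\varepsilon^n}{\Delta t}=\frac{v_\varepsilon^{n+1}}{\varepsilon},\qquad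 \varepsilon\,\frac{v_\varepsilon^{n+1}-v_\varepsilon^n}{\Delta t}=E(t_n,x_\varepsilon^n)-\frac{(v_\varepsilon^{n+1})^\perp}{\varepsilon},\qquad x_\varepsilon^0=x^0,\quad v_\varepsilon^0=v^0,$$ and set $y_\varepsilon(t)=x_\varepsilon(t)-\varepsilon v_\varepsilon^\perp(t)$, $y_\varepsilon^n=x_\varepsilon^n-\varepsilon (v_\varepsilon^n)^\perp$. **Theorem.** For all $\varepsilon>0$, $\Delta t>0$ and $(x^0,v^0)$ the scheme has a unique solution $(x_\varepsilon^n,v_\varepsilon^n)_{n\ge0}$. Moreover: (i) If $E\in W^{1,\infty}$, there is a constant $C$ depending only on $E$ such that for all $n\ge0$, $\Delta t>0$, $\varepsilon>0$ and all $(x^0,v^0)$, $$\|x_\varepsilon^n-x_\varepsilon(t_n)\|\le C\,(1+t_n^2)\,e^{2K_xt_n}\,(1+\|v^0\|+\varepsilon)\,\min\Big(\frac{\Delta t}{\varepsilon^3}(1+\varepsilon^2),\ \Delta t+\varepsilon\Big).$$ (ii) If $E\in W^{2,\infty}$, there is a constant $C$ depending only on $E$ such that for all $n\ge0$, $\Delta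 t>0$, $\varepsilon>0$ and all $(x^0,v^0)$, $$\|y_\varepsilon^n-y_\varepsilon(t_n)\|\le C\,(1+t_n^4)\,e^{2K_xt_n}\,(1+\|v^0\|^2+\varepsilon^2)\,\min\Big(\frac{\Delta t}{\varepsilon^3}(1+\varepsilon),\ \Delta t+\varepsilon^2\Big).$$ -/

import Mathlib

open MeasureTheory Set

noncomputable section

namespace Sobolev

variable {G F : Type*} [NormedAddCommGroup G] [NormedSpace ℝ G] [MeasureSpace G]
  [NormedAddCommGroup F] [NormedSpace ℝ F]

/-- `g` is a weak (distributional) total derivative of `f` on the open set `Ω`: both are locally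
integrable on `Ω`, and `∫ (∂_w φ) f = - ∫ φ (g w)` for every direction `w` and every smooth
compactly supported test function `φ` with support in `Ω`. -/
structure HasWeakFDerivOn (Ω : Set G) (f : G → F) (g : G → (G →L[ℝ] F)) : Prop where
  locallyIntegrableOn : LocallyIntegrableOn f Ω volume
  locallyIntegrableOn_deriv : LocallyIntegrableOn g Ω volume
  integral_eq : ∀ φ : G → ℝ, ContDiff ℝ (⊤ : ℕ∞) φ → HasCompactSupport φ → tsupport φ ⊆ Ω →
    ∀ w : G, ∫ p, (fderiv ℝ φ p w) • f p = - ∫ p, φ p • g p w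

open Classical in
/-- The weak total derivative of `f` on `Ω` (unique up to a null set of `Ω`); zero if there is
none. -/
def weakFDeriv (Ω : Set G) (f : G → F) : G → (G →L[ℝ] F) :=
  if h : ∃ g, HasWeakFDerivOn Ω f g then h.choose else 0

/-- The Sobolev space `W^{1,∞}(Ω)`: functions in `L^∞(Ω)` which have a weak derivative, itself
in `L^∞(Ω)`. -/
structure MemW1Inf (Ω : Set G) (f : G → F) : Prop where
  memLp : MemLp f ⊤ (volume.restrict Ω)
  exists_weakFDeriv : ∃ g, HasWeakFDerivOn Ω f g
  memLp_weakFDeriv : MemLp (weakFDeriv Ω f) ⊤ (volume.restrict Ω)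

/-- The Sobolev space `W^{2,∞}(Ω)`: functions in `L^∞(Ω)` which have a weak derivative, itself
in `W^{1,∞}(Ω)`. -/
structure MemW2Inf (Ω : Set G) (f : G → F) : Prop where
  memLp : MemLp f ⊤ (volume.restrict Ω)
  exists_weakFDeriv : ∃ g, HasWeakFDerivOn Ω f g
  memW1Inf_weakFDeriv : MemW1Inf Ω (weakFDeriv Ω f)

end Sobolev

namespace Particle

/-- The Euclidean plane. -/
abbrev Plane : Type := EuclideanSpace ℝ (Fin 2)

/-- Rotation by a quarter turn, `v^⊥ = (-v₂, v₁)`. -/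
def perp (v : Plane) : Plane := !₂[-(v 1), v 0]

/-- The space-time domain `(0,∞) × ℝ²`. -/
def spaceTime : Set (ℝ × Plane) := Ioi 0 ×ˢ univ

/-- `K_x = ‖D_x E‖_{L^∞((0,∞) × ℝ²)}`: the essential supremum of the Euclidean operator norm of
the spatial part of the weak derivative of `E`. -/
def Kx (E : ℝ × Plane → Plane) : ℝ :=
  (eLpNorm (fun p => (Sobolev.weakFDeriv spaceTime E p).comp (ContinuousLinearMap.inr ℝ ℝ Plane))
    ⊤ (volume.restrict spaceTime)).toReal

/-- `(x, v)` solves, on `[0,∞)`, the characteristic system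
`ε x' = v`, `ε v' = E(t, x) - v^⊥ / ε`, with `x(0) = x₀`, `v(0) = v₀`. -/
structure IsTrajectory (E : ℝ × Plane → Plane) (ε : ℝ) (x₀ v₀ : Plane) (x v : ℝ → Plane) :
    Prop where
  init_x : x 0 = x₀
  init_v : v 0 = v₀
  deriv_x : ∀ t : ℝ, 0 ≤ t → HasDerivWithinAt x (ε⁻¹ • v t) (Ici 0) t
  deriv_v : ∀ t : ℝ, 0 ≤ t →
    HasDerivWithinAt v (ε⁻¹ • (E (t, x t) - ε⁻¹ • perp (v t))) (Ici 0) t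

/-- `(xn, vn)` solves the first-order scheme with time step `Δt`, implicit in the velocity and
explicit in the field `E`, started at `(x₀, v₀)`. -/
structure IsScheme (E : ℝ × Plane → Plane) (ε Δt : ℝ) (x₀ v₀ : Plane) (xn vn : ℕ → Plane) :
    Prop where
  init_x : xn 0 = x₀
  init_v : vn 0 = v₀
  step_x : ∀ n : ℕ, Δt⁻¹ • (xn (n + 1) - xn n) = ε⁻¹ • vn (n + 1)
  step_v : ∀ n : ℕ,
    ε • (Δt⁻¹ • (vn (n + 1) - vn n)) = E (n * Δt, xn n) - ε⁻¹ • perp (vn (n + 1))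

/-- The guiding-center variable `y = x - ε v^⊥`. -/
def guidingCenter (ε : ℝ) (x v : Plane) : Plane := x - ε • perp v

end Particle

end

noncomputable section

/-!
Mollification shows that `W^{1,∞}` and `W^{2,∞}` fields are classical: `E` is bounded and Lipschitz,
in space with constant `K_x`, and in the second case `E` has a spatial derivative `D` which is
Lipschitz as well.

The guiding center satisfies `y' = -E(t, x)^⊥`, and the scheme satisfies the corresponding exact
recursion `y_{n+1} = y_n - Δt E(t_n, x_n)^⊥`. Since `‖x - y‖ = ε ‖v‖`, both are perturbations of the
limit equation `y' = -E(t, y)^⊥` and of its Euler scheme, and Gronwall's inequality yields an error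
of order `Δt + ε`. The velocities are controlled uniformly in `Δt` through `v + ε E^⊥`, whose norm
the implicit step does not increase when `E` is frozen.

For the order `ε²`, the next Taylor term `ε D v^⊥` oscillates: up to terms of higher order `v^⊥` is
a time derivative (respectively a difference) of `-ε² v`, so summation by parts gains a factor `ε`.
For fixed `ε`, the implicit step is a contraction of the stiff system, which gives order `Δt`.
-/

open Filter Topology Metric ContinuousLinearMap
open scoped Convolution

namespace Sobolev

theorem ae_norm_le_toReal {α F : Type*} [MeasurableSpace α] [NormedAddCommGroup F]
    {μ : Measure α} {f : α → F} (hf : eLpNorm f ⊤ μ ≠ ⊤) :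
    ∀ᵐ q ∂μ, ‖f q‖ ≤ (eLpNorm f ⊤ μ).toReal := by
  filter_upwards [ae_le_eLpNormEssSup (f := f) (μ := μ)] with q hq
  rw [← toReal_enorm]
  exact ENNReal.toReal_mono hf (by rwa [eLpNorm_exponent_top])

theorem locallyIntegrable_indicator {X F : Type*} [TopologicalSpace X] [MeasurableSpace X]
    [NormedAddCommGroup F] {μ : Measure X} [IsLocallyFiniteMeasure μ] {s : Set X} {f : X → F}
    (hs : MeasurableSet s) (hf : MemLp f ⊤ (μ.restrict s)) :
    LocallyIntegrable (s.indicator f) μ :=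
  ((memLp_indicator_iff_restrict hs).2 hf).locallyIntegrable le_top

section WeakDerivative

variable {G F : Type*} [NormedAddCommGroup G] [NormedSpace ℝ G] [MeasureSpace G]
  [NormedAddCommGroup F] [NormedSpace ℝ F] {Ω : Set G} {f : G → F} {g : G → G →L[ℝ] F}

theorem hasWeakFDerivOn_weakFDeriv (h : ∃ g, HasWeakFDerivOn Ω f g) :
    HasWeakFDerivOn Ω f (weakFDeriv Ω f) := by
  rw [weakFDeriv, dif_pos h]
  exact h.choose_spec

/-- `g` is a weak derivative of `f` on `Ω`, and both are essentially bounded on `Ω`, that is, they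
witness `f ∈ W^{1,∞}(Ω)`. -/
structure HasBoundedWeakFDerivOn (Ω : Set G) (f : G → F) (g : G → G →L[ℝ] F) : Prop
    extends HasWeakFDerivOn Ω f g where
  memLp : MemLp f ⊤ (volume.restrict Ω)
  memLp_deriv : MemLp g ⊤ (volume.restrict Ω)

theorem MemW1Inf.hasBoundedWeakFDerivOn (h : MemW1Inf Ω f) :
    HasBoundedWeakFDerivOn Ω f (weakFDeriv Ω f) :=
  ⟨hasWeakFDerivOn_weakFDeriv h.exists_weakFDeriv, h.memLp, h.memLp_weakFDeriv⟩

theorem MemW2Inf.memW1Inf (h : MemW2Inf Ω f) : MemW1Inf Ω f :=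
  ⟨h.memLp, h.exists_weakFDeriv, h.memW1Inf_weakFDeriv.memLp⟩

theorem HasWeakFDerivOn.integral_indicator_eq (h : HasWeakFDerivOn Ω f g) {φ : G → ℝ}
    (hφ : ContDiff ℝ (⊤ : ℕ∞) φ) (hφc : HasCompactSupport φ) (hφΩ : tsupport φ ⊆ Ω) (w : G) :
    ∫ p, fderiv ℝ φ p w • Ω.indicator f p = -∫ p, φ p • Ω.indicator g p w := by
  have hd p (hp : p ∉ Ω) : fderiv ℝ φ p = 0 :=
    Function.notMem_support.1 fun h' => hp (hφΩ (support_fderiv_subset ℝ h'))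
  have h0 p (hp : p ∉ Ω) : φ p = 0 := image_eq_zero_of_notMem_tsupport fun h' => hp (hφΩ h')
  have hf p : fderiv ℝ φ p w • Ω.indicator f p = fderiv ℝ φ p w • f p := by
    by_cases hp : p ∈ Ω <;> simp [hp, hd]
  have hg p : φ p • Ω.indicator g p w = φ p • g p w := by
    by_cases hp : p ∈ Ω <;> simp [hp, h0]
  simpa only [hf, hg] using h.integral_eq φ hφ hφc hφΩ w

variable [BorelSpace G] [FiniteDimensional ℝ G] [(volume : Measure G).IsAddHaarMeasure]

theorem HasWeakFDerivOn.hasFDerivAt_convolution_indicator (h : HasWeakFDerivOn Ω f g)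
    (hf : LocallyIntegrable (Ω.indicator f)) (hg : LocallyIntegrable (Ω.indicator g))
    {φ : G → ℝ} (hφ : ContDiff ℝ (⊤ : ℕ∞) φ) (hφc : HasCompactSupport φ) {p : G}
    (hp : ∀ q, p - q ∈ tsupport φ → q ∈ Ω) :
    HasFDerivAt (φ ⋆ Ω.indicator f) ((φ ⋆ Ω.indicator g) p) p := by
  have hφ1 : ContDiff ℝ 1 φ := hφ.of_le (mod_cast le_top)
  let ψ : G → ℝ := φ ∘ Homeomorph.subLeft p
  have hψ : tsupport ψ = Homeomorph.subLeft p ⁻¹' tsupport φ :=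
    tsupport_comp_eq_preimage φ (Homeomorph.subLeft p)
  have hψ' q w : fderiv ℝ ψ q w = -fderiv ℝ φ (p - q) w := by
    have hφq := (hφ1.differentiable one_ne_zero (p - q)).hasFDerivAt
    have hψq : HasFDerivAt ψ _ q := hφq.comp q ((hasFDerivAt_id q).const_sub p)
    rw [hψq.fderiv]
    simp
  have hint := h.integral_indicator_eq (φ := ψ) (hφ.comp (contDiff_const.sub contDiff_id))
    (hφc.comp_homeomorph _) (fun q hq => hp q (by rwa [hψ] at hq))
  convert! hφc.hasFDerivAt_convolution_left (lsmul ℝ ℝ) hφ1 hf p using 1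
  ext w
  have hL := (hφc.fderiv (𝕜 := ℝ)).convolutionExists_left ((lsmul ℝ ℝ).precompL G)
    (hφ1.continuous_fderiv one_ne_zero) hf p
  have hR := hφc.convolutionExists_left (lsmul ℝ ℝ) hφ.continuous hg p
  rw [convolution_eq_swap, convolution_eq_swap, integral_apply hL.integrable_swap,
    integral_apply hR.integrable_swap]
  calc ∫ q, φ (p - q) • Ω.indicator g q w = -∫ q, fderiv ℝ ψ q w • Ω.indicator f q := by
        rw [hint w, neg_neg]
        rfl
    _ = ∫ q, fderiv ℝ φ (p - q) w • Ω.indicator f q := by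
        simp only [hψ', neg_smul, integral_neg, neg_neg]

theorem convolution_mem {φ : G → ℝ} (hφ : Measurable φ) (hφ0 : ∀ q, 0 ≤ φ q)
    (hφ1 : ∫ q, φ q = 1) {p : G} (hconv : ConvolutionExistsAt φ f p (lsmul ℝ ℝ)) {s : Set F}
    (hs : Convex ℝ s) (hsc : IsClosed s) (hfs : ∀ᵐ q, φ (p - q) ≠ 0 → f q ∈ s) [CompleteSpace F] :
    (φ ⋆ f) p ∈ s := by
  have hm : Measurable fun q => (φ (p - q)).toNNReal :=
    (hφ.comp (measurable_const.sub measurable_id)).real_toNNReal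
  have hsmul q : (φ (p - q)).toNNReal • f q = φ (p - q) • f q := by
    rw [NNReal.smul_def, Real.coe_toNNReal _ (hφ0 _)]
  let μ : Measure G := volume.withDensity fun q => ((φ (p - q)).toNNReal : ENNReal)
  have hμ : IsProbabilityMeasure μ := by
    have hφi : Integrable fun q => φ (p - q) := (integrable_of_integral_eq_one hφ1).comp_sub_left p
    have h := ofReal_integral_eq_lintegral_ofReal hφi (.of_forall fun q => hφ0 (p - q))
    rw [integral_sub_left_eq_self φ volume p, hφ1, ENNReal.ofReal_one] at h
    exact ⟨by rw [withDensity_apply _ .univ, setLIntegral_univ, h]; rfl⟩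
  have hconv' : Integrable (fun q => φ (p - q) • f q) := hconv.integrable_swap
  have hint : Integrable f μ := by
    rw [integrable_withDensity_iff_integrable_smul hm]
    simpa only [hsmul] using hconv'
  have hmem : ∀ᵐ q ∂μ, f q ∈ s := by
    rw [ae_withDensity_iff hm.coe_nnreal_ennreal]
    filter_upwards [hfs] with q hq h0
    exact hq fun h => h0 (by simp [h])
  rw [convolution_lsmul_swap]
  simpa only [μ, integral_withDensity_eq_integral_smul hm, hsmul]
    using hs.integral_mem hsc hmem hint

end WeakDerivative

section HalfSpace

/-- The open half space `(0,∞) × G` of positive times. -/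
def halfSpace (G : Type*) : Set (ℝ × G) := Ioi 0 ×ˢ univ

theorem mem_halfSpace {G : Type*} {p : ℝ × G} : p ∈ halfSpace G ↔ 0 < p.1 := by simp [halfSpace]

theorem measurableSet_halfSpace {G : Type*} [MeasurableSpace G] : MeasurableSet (halfSpace G) :=
  measurableSet_Ioi.prod .univ

variable {G F : Type*} [NormedAddCommGroup G] [NormedAddCommGroup F] {p w : ℝ × G}

theorem mem_halfSpace_and_dist_le {n : ℕ} {q : ℝ × G} (hp : 0 ≤ p.1)
    (h : p - q ∈ closedBall ((-(1 / (n + 1)), 0) : ℝ × G) (1 / (n + 1) / 2)) :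
    q ∈ halfSpace G ∧ dist q p ≤ 2 * (1 / (n + 1)) := by
  have hδ : (0 : ℝ) < 1 / (n + 1) := Nat.one_div_pos_of_nat
  generalize (1 : ℝ) / (n + 1) = δ at *
  rw [mem_closedBall, dist_eq_norm] at h
  have htime : |p.1 - q.1 + δ| ≤ δ / 2 := by simpa using (_root_.norm_fst_le _).trans h
  have hshift : ‖((-δ, 0) : ℝ × G)‖ = δ := by simp [Prod.norm_def, abs_of_pos hδ, hδ.le]
  refine ⟨mem_halfSpace.2 (by linarith [le_abs_self (p.1 - q.1 + δ)]), ?_⟩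
  calc dist q p = ‖(p - q - (-δ, 0)) + (-δ, 0)‖ := by rw [sub_add_cancel, dist_comm, dist_eq_norm]
    _ ≤ δ / 2 + δ := (norm_add_le _ _).trans (add_le_add h hshift.le)
    _ ≤ 2 * δ := by linarith

variable [NormedSpace ℝ G]

theorem fst_add_smul_nonneg (hp : 0 ≤ p.1) (hpw : 0 ≤ (p + w).1) {s : ℝ}
    (hs : s ∈ Icc (0 : ℝ) 1) : 0 ≤ (p + s • w).1 :=
  (convex_Ici (0 : ℝ)).add_smul_mem hp hpw hs

/-- A bump function whose support, a ball around `(-1/(n+1), 0)`, contains only negative times: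
convolution with it evaluates a function at later times only, so that it regularizes functions on
the half space up to the boundary. -/
def inwardBump (G : Type*) [NormedAddCommGroup G] [NormedSpace ℝ G] (n : ℕ) :
    ContDiffBump ((-(1 / (n + 1)), 0) : ℝ × G) where
  rIn := 1 / (n + 1) / 4
  rOut := 1 / (n + 1) / 2
  rIn_pos := by positivity
  rIn_lt_rOut := by gcongr; norm_num

variable [MeasureSpace G] [BorelSpace G] [FiniteDimensional ℝ G]
  [(volume : Measure G).IsAddHaarMeasure]

instance : (volume : Measure (ℝ × G)).IsAddHaarMeasure :=
  inferInstanceAs ((volume : Measure ℝ).prod (volume : Measure G)).IsAddHaarMeasure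

variable [NormedSpace ℝ F]

/-- The `n`-th mollification of a function on the half space, meaningful on the closed half
space. -/
def mollify (n : ℕ) (f : ℝ × G → F) : ℝ × G → F :=
  (inwardBump G n).normed volume ⋆ (halfSpace G).indicator f

variable {f : ℝ × G → F} {g : ℝ × G → ℝ × G →L[ℝ] F} {H : ℝ × G → ℝ × G →L[ℝ] ℝ × G →L[ℝ] F}

theorem HasBoundedWeakFDerivOn.hasFDerivAt_mollify (h : HasBoundedWeakFDerivOn (halfSpace G) f g)
    (n : ℕ) (hp : 0 ≤ p.1) : HasFDerivAt (mollify n f) (mollify n g p) p := by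
  refine h.hasFDerivAt_convolution_indicator (locallyIntegrable_indicator measurableSet_halfSpace
    h.memLp) (locallyIntegrable_indicator measurableSet_halfSpace h.memLp_deriv)
    (inwardBump G n).contDiff_normed (inwardBump G n).hasCompactSupport_normed fun q hq => ?_
  rw [ContDiffBump.tsupport_normed_eq] at hq
  exact (mem_halfSpace_and_dist_le hp hq).1

theorem HasBoundedWeakFDerivOn.hasDerivWithinAt_mollify_segment
    (h : HasBoundedWeakFDerivOn (halfSpace G) f g) (n : ℕ) {s : ℝ} (hs : 0 ≤ (p + s • w).1)
    (S : Set ℝ) :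
    HasDerivWithinAt (fun s : ℝ => mollify n f (p + s • w)) (mollify n g (p + s • w) w) S s := by
  have hline : HasDerivAt (fun s : ℝ => p + s • w) w s := by
    simpa using ((hasDerivAt_id s).smul_const w).const_add p
  exact ((h.hasFDerivAt_mollify n hs).comp_hasDerivAt s hline).hasDerivWithinAt

section Complete

variable [CompleteSpace F]

theorem mollify_mem (hf : MemLp f ⊤ (volume.restrict (halfSpace G))) {n : ℕ}
    (hp : 0 ≤ p.1) {s : Set F} (hs : Convex ℝ s) (hsc : IsClosed s)
    (hfs : ∀ᵐ q ∂volume.restrict (halfSpace G), dist q p ≤ 2 * (1 / (n + 1)) → f q ∈ s) :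
    mollify n f p ∈ s := by
  have hφ : Continuous ((inwardBump G n).normed volume) := (inwardBump G n).continuous_normed
  refine convolution_mem hφ.measurable (inwardBump G n).nonneg_normed
    (inwardBump G n).integral_normed
    ((inwardBump G n).hasCompactSupport_normed.convolutionExists_left _ hφ
      (locallyIntegrable_indicator measurableSet_halfSpace hf) p) hs hsc ?_
  rw [ae_restrict_iff' measurableSet_halfSpace] at hfs
  filter_upwards [hfs] with q hq hpq
  rw [← Function.mem_support, ContDiffBump.support_normed_eq] at hpq
  obtain ⟨hqG, hqp⟩ := mem_halfSpace_and_dist_le hp (ball_subset_closedBall hpq)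
  simpa [hqG] using hq hqG hqp

theorem norm_mollify_le (hf : MemLp f ⊤ (volume.restrict (halfSpace G)))
    (n : ℕ) (hp : 0 ≤ p.1) {C : ℝ} (hC : ∀ᵐ q ∂volume.restrict (halfSpace G), ‖f q‖ ≤ C) :
    ‖mollify n f p‖ ≤ C := by
  refine mem_closedBall_zero_iff.1
    (mollify_mem hf hp (convex_closedBall 0 C) isClosed_closedBall ?_)
  filter_upwards [hC] with q hq _
  exact mem_closedBall_zero_iff.2 hq

theorem tendsto_mollify (hf : MemLp f ⊤ (volume.restrict (halfSpace G)))
    (hc : ContinuousOn f (Ici 0 ×ˢ univ)) (hp : 0 ≤ p.1) :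
    Tendsto (mollify · f p) atTop (𝓝 (f p)) := by
  refine Metric.nhds_basis_closedBall.tendsto_right_iff.2 fun ε hε => ?_
  obtain ⟨δ, hδ, hfδ⟩ := Metric.continuousWithinAt_iff.1 (hc p ⟨hp, mem_univ _⟩) ε hε
  have hsmall : ∀ᶠ n : ℕ in atTop, 2 * (1 / ((n : ℝ) + 1)) < δ := by
    refine Tendsto.eventually_lt_const (v := 2 * 0) (by simpa using hδ) ?_
    exact tendsto_one_div_add_atTop_nhds_zero_nat.const_mul 2
  filter_upwards [hsmall] with n hn
  refine mollify_mem hf hp (convex_closedBall (f p) ε) isClosed_closedBall ?_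
  filter_upwards [ae_restrict_mem measurableSet_halfSpace] with q hq hqp
  exact (hfδ ⟨(mem_halfSpace.1 hq).le, mem_univ _⟩ (hqp.trans_lt hn)).le

theorem norm_le_of_continuousOn (hf : MemLp f ⊤ (volume.restrict (halfSpace G)))
    (hc : ContinuousOn f (Ici 0 ×ˢ univ)) (hp : 0 ≤ p.1) {C : ℝ}
    (hC : ∀ᵐ q ∂volume.restrict (halfSpace G), ‖f q‖ ≤ C) : ‖f p‖ ≤ C :=
  le_of_tendsto (tendsto_mollify hf hc hp).norm (.of_forall fun n => norm_mollify_le hf n hp hC)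

namespace HasBoundedWeakFDerivOn

theorem norm_mollify_sub_le (h : HasBoundedWeakFDerivOn (halfSpace G) f g) (n : ℕ) (hp : 0 ≤ p.1)
    (hpw : 0 ≤ (p + w).1) {C : ℝ} (hC : ∀ᵐ q ∂volume.restrict (halfSpace G), ‖g q w‖ ≤ C) :
    ‖mollify n f (p + w) - mollify n f p‖ ≤ C := by
  have hbound q (hq : 0 ≤ q.1) : ‖mollify n g q w‖ ≤ C := by
    refine mem_closedBall_zero_iff.1 (mollify_mem h.memLp_deriv hq
      (s := apply ℝ F w ⁻¹' closedBall 0 C)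
      ((convex_closedBall 0 C).is_linear_preimage (apply ℝ F w).isBoundedLinearMap.toIsLinearMap)
      (isClosed_closedBall.preimage (apply ℝ F w).continuous) ?_)
    filter_upwards [hC] with q hq _
    simpa using hq
  simpa using norm_image_sub_le_of_norm_deriv_le_segment_01'
    (fun s hs => h.hasDerivWithinAt_mollify_segment n (fst_add_smul_nonneg hp hpw hs) _)
    fun s hs => hbound _ (fst_add_smul_nonneg hp hpw (Ico_subset_Icc_self hs))

theorem norm_sub_le (h : HasBoundedWeakFDerivOn (halfSpace G) f g)
    (hc : ContinuousOn f (Ici 0 ×ˢ univ)) (hp : 0 ≤ p.1) (hpw : 0 ≤ (p + w).1) {C : ℝ}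
    (hC : ∀ᵐ q ∂volume.restrict (halfSpace G), ‖g q w‖ ≤ C) : ‖f (p + w) - f p‖ ≤ C :=
  le_of_tendsto ((tendsto_mollify h.memLp hc hpw).sub (tendsto_mollify h.memLp hc hp)).norm
    (.of_forall fun n => h.norm_mollify_sub_le n hp hpw hC)

theorem norm_mollify_taylor_le (h : HasBoundedWeakFDerivOn (halfSpace G) f g)
    (h' : HasBoundedWeakFDerivOn (halfSpace G) g H) (n : ℕ) (hp : 0 ≤ p.1) (hpw : 0 ≤ (p + w).1)
    {Q : ℝ} (hQ : ∀ᵐ q ∂volume.restrict (halfSpace G), ‖H q‖ ≤ Q) :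
    ‖mollify n f (p + w) - mollify n f p - mollify n g p w‖ ≤ Q * ‖w‖ ^ 2 := by
  have hderiv s (hs : s ∈ Icc (0 : ℝ) 1) :
      HasDerivWithinAt (fun s : ℝ => mollify n f (p + s • w) - s • mollify n g p w)
        (mollify n g (p + s • w) w - mollify n g p w) (Icc 0 1) s := by
    simpa using (h.hasDerivWithinAt_mollify_segment n (fst_add_smul_nonneg hp hpw hs) _).fun_sub
      ((hasDerivWithinAt_id s _).smul_const (mollify n g p w))
  have hbound s (hs : s ∈ Ico (0 : ℝ) 1) :
      ‖mollify n g (p + s • w) w - mollify n g p w‖ ≤ Q * ‖w‖ ^ 2 := by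
    have hHs : ∀ᵐ q ∂volume.restrict (halfSpace G), ‖H q (s • w)‖ ≤ Q * ‖w‖ := by
      filter_upwards [hQ] with q hq
      refine (H q).le_of_opNorm_le_of_le hq ?_
      rw [norm_smul, Real.norm_of_nonneg hs.1]
      exact mul_le_of_le_one_left (norm_nonneg w) hs.2.le
    rw [← sub_apply, sq, ← mul_assoc]
    exact le_of_opNorm_le _ (h'.norm_mollify_sub_le n hp
      (fst_add_smul_nonneg hp hpw (Ico_subset_Icc_self hs)) hHs) w
  simpa [sub_right_comm] using norm_image_sub_le_of_norm_deriv_le_segment_01' hderiv hbound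

end HasBoundedWeakFDerivOn

end Complete

theorem HasBoundedWeakFDerivOn.exists_lipschitz_deriv [FiniteDimensional ℝ F]
    (h : HasBoundedWeakFDerivOn (halfSpace G) f g)
    (h' : HasBoundedWeakFDerivOn (halfSpace G) g H) (hc : ContinuousOn f (Ici 0 ×ˢ univ)) {Q : ℝ}
    (hQ : ∀ᵐ q ∂volume.restrict (halfSpace G), ‖H q‖ ≤ Q) {s : Set (ℝ × G →L[ℝ] F)}
    (hs : Convex ℝ s) (hsc : IsClosed s) (hgs : ∀ᵐ q ∂volume.restrict (halfSpace G), g q ∈ s) :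
    ∃ D : ℝ × G → ℝ × G →L[ℝ] F, ∀ p : ℝ × G, 0 ≤ p.1 → D p ∈ s ∧ ∀ w : ℝ × G, 0 ≤ (p + w).1 →
      ‖D (p + w) - D p‖ ≤ Q * ‖w‖ ∧ ‖f (p + w) - f p - D p w‖ ≤ Q * ‖w‖ ^ 2 := by
  have : CompleteSpace F := FiniteDimensional.complete ℝ F
  let U : Ultrafilter ℕ := hyperfilter ℕ
  have hU : (U : Filter ℕ) ≤ atTop := Nat.hyperfilter_le_atTop
  have hlim p : ∃ A, 0 ≤ p.1 → Tendsto (mollify · g p) U (𝓝 A) := by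
    by_cases hp : 0 ≤ p.1
    · have hball n : mollify n g p ∈ closedBall 0 _ := mem_closedBall_zero_iff.2
        (norm_mollify_le h'.memLp n hp (ae_norm_le_toReal h'.memLp.2.ne))
      obtain ⟨A, -, hA⟩ := (isCompact_closedBall _ _).ultrafilter_le_nhds
        (U.map (mollify · g p)) (tendsto_principal.2 (.of_forall hball))
      exact ⟨A, fun _ => hA⟩
    · exact ⟨0, fun hp' => absurd hp' hp⟩
  choose D hD using hlim
  have hDw p w (hp : 0 ≤ p.1) : Tendsto (mollify · g p w) U (𝓝 (D p w)) :=
    ((apply ℝ F w).continuous.tendsto (D p)).comp (hD p hp)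
  have hf p (hp : 0 ≤ p.1) : Tendsto (mollify · f p) U (𝓝 (f p)) :=
    (tendsto_mollify h.memLp hc hp).mono_left hU
  refine ⟨D, fun p hp => ⟨hsc.mem_of_tendsto (hD p hp) (.of_forall fun n => ?_),
    fun w hpw => ⟨le_of_tendsto ((hD _ hpw).sub (hD p hp)).norm (.of_forall fun n => ?_),
      le_of_tendsto (((hf _ hpw).sub (hf p hp)).sub (hDw p w hp)).norm
        (.of_forall fun n => h.norm_mollify_taylor_le h' n hp hpw hQ)⟩⟩⟩
  · exact mollify_mem h'.memLp hp hs hsc (hgs.mono fun _ hq _ => hq)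
  · exact h'.norm_mollify_sub_le n hp hpw (hQ.mono fun q hq => (H q).le_of_opNorm_le hq w)

end HalfSpace

section LipschitzField

variable {G F : Type*} [NormedAddCommGroup G] [NormedAddCommGroup F]

/-- At nonnegative times, the time-dependent field `E` is bounded by `M` and Lipschitz, with
constant `M` in time and `K` in space. -/
structure IsLipschitzField (E : ℝ × G → F) (M K : ℝ) : Prop where
  space_nonneg : 0 ≤ K
  norm_le : ∀ {t : ℝ} (x : G), 0 ≤ t → ‖E (t, x)‖ ≤ M
  norm_sub_le : ∀ {s t : ℝ} (x y : G), 0 ≤ s → 0 ≤ t →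
    ‖E (t, x) - E (s, y)‖ ≤ M * |t - s| + K * ‖x - y‖

theorem IsLipschitzField.bound_nonneg {E : ℝ × G → F} {M K : ℝ} (hE : IsLipschitzField E M K) :
    0 ≤ M :=
  (norm_nonneg _).trans (hE.norm_le 0 le_rfl)

variable [NormedSpace ℝ G] [NormedSpace ℝ F]

/-- At nonnegative times, `D` is the spatial derivative of `E`: it is bounded by `K`, Lipschitz
with constant `Q`, and controls the first-order Taylor remainder of `E`. -/
structure IsLipschitzDeriv (E : ℝ × G → F) (D : ℝ × G → G →L[ℝ] F) (K Q : ℝ) : Prop where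
  nonneg : 0 ≤ Q
  norm_le : ∀ {t : ℝ} (x : G), 0 ≤ t → ‖D (t, x)‖ ≤ K
  norm_sub_le : ∀ {s t : ℝ} (x y : G), 0 ≤ s → 0 ≤ t →
    ‖D (t, x) - D (s, y)‖ ≤ Q * (|t - s| + ‖x - y‖)
  taylor : ∀ {t : ℝ} (x h : G), 0 ≤ t → ‖E (t, x + h) - E (t, x) - D (t, x) h‖ ≤ Q * ‖h‖ ^ 2

theorem norm_comp_inr_le (A : ℝ × G →L[ℝ] F) : ‖A.comp (inr ℝ ℝ G)‖ ≤ ‖A‖ :=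
  (A.opNorm_comp_le _).trans (mul_le_of_le_one_right (norm_nonneg A) (norm_inr_le_one ℝ ℝ G))

variable [MeasureSpace G] [BorelSpace G] [FiniteDimensional ℝ G]
  [(volume : Measure G).IsAddHaarMeasure] {E : ℝ × G → F} {g : ℝ × G → ℝ × G →L[ℝ] F}
  {H : ℝ × G → ℝ × G →L[ℝ] ℝ × G →L[ℝ] F} {K : ℝ}

theorem HasBoundedWeakFDerivOn.exists_isLipschitzField [CompleteSpace F]
    (h : HasBoundedWeakFDerivOn (halfSpace G) E g) (hc : ContinuousOn E (Ici 0 ×ˢ univ))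
    (hK₀ : 0 ≤ K)
    (hK : ∀ᵐ q ∂volume.restrict (halfSpace G), ‖(g q).comp (inr ℝ ℝ G)‖ ≤ K) :
    ∃ M, IsLipschitzField E M K := by
  have hE := ae_norm_le_toReal h.memLp.2.ne
  have hg := ae_norm_le_toReal h.memLp_deriv.2.ne
  set M := (eLpNorm E ⊤ (volume.restrict (halfSpace G))).toReal
  set L := (eLpNorm g ⊤ (volume.restrict (halfSpace G))).toReal
  refine ⟨max M L, hK₀, fun {t} x ht => ?_, fun {s t} x y hs ht => ?_⟩
  · exact (norm_le_of_continuousOn h.memLp hc (p := (t, x)) ht hE).trans (le_max_left M L)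
  have htime : ‖E (t, x) - E (s, x)‖ ≤ L * |t - s| := by
    have := h.norm_sub_le hc (p := (s, x)) (w := (t - s, 0)) hs (by simpa using ht)
      (C := L * |t - s|) (hg.mono fun q hq => by simpa using (g q).le_of_opNorm_le hq (t - s, 0))
    simpa using this
  have hspace : ‖E (s, x) - E (s, y)‖ ≤ K * ‖x - y‖ := by
    have := h.norm_sub_le hc (p := (s, y)) (w := (0, x - y)) hs (by simpa using hs)
      (hK.mono fun q hq => ((g q).comp (inr ℝ ℝ G)).le_of_opNorm_le hq (x - y))
    simpa using this
  calc ‖E (t, x) - E (s, y)‖ ≤ ‖E (t, x) - E (s, x)‖ + ‖E (s, x) - E (s, y)‖ :=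
        norm_sub_le_norm_sub_add_norm_sub _ _ _
    _ ≤ max M L * |t - s| + K * ‖x - y‖ := by grw [htime, hspace, ← le_max_right M L]

theorem HasBoundedWeakFDerivOn.exists_isLipschitzDeriv [FiniteDimensional ℝ F]
    (h : HasBoundedWeakFDerivOn (halfSpace G) E g)
    (h' : HasBoundedWeakFDerivOn (halfSpace G) g H) (hc : ContinuousOn E (Ici 0 ×ˢ univ))
    (hK : ∀ᵐ q ∂volume.restrict (halfSpace G), ‖(g q).comp (inr ℝ ℝ G)‖ ≤ K) :
    ∃ D Q, IsLipschitzDeriv E D K Q := by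
  let spacePart : (ℝ × G →L[ℝ] F) →L[ℝ] (G →L[ℝ] F) := (compL ℝ G (ℝ × G) F).flip (inr ℝ ℝ G)
  obtain ⟨D, hD⟩ := h.exists_lipschitz_deriv h' hc (ae_norm_le_toReal h'.memLp_deriv.2.ne)
    (s := spacePart ⁻¹' closedBall 0 K)
    ((convex_closedBall 0 K).is_linear_preimage spacePart.isBoundedLinearMap.toIsLinearMap)
    (isClosed_closedBall.preimage spacePart.continuous)
    (hK.mono fun q hq => by simpa [spacePart] using hq)
  set Q := (eLpNorm H ⊤ (volume.restrict (halfSpace G))).toReal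
  have hQ₀ : 0 ≤ Q := ENNReal.toReal_nonneg
  refine ⟨fun p => (D p).comp (inr ℝ ℝ G), Q, hQ₀, fun {t} x ht => ?_, fun {s t} x y hs ht => ?_,
    fun {t} x w ht => ?_⟩
  · simpa [spacePart] using (hD (t, x) ht).1
  · have hDsub := ((hD (s, y) hs).2 (t - s, x - y) (by simpa using ht)).1
    rw [← sub_comp]
    grw [norm_comp_inr_le]
    calc ‖D (t, x) - D (s, y)‖ ≤ Q * ‖(t - s, x - y)‖ := by simpa using hDsub
      _ ≤ Q * (|t - s| + ‖x - y‖) := by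
        gcongr
        exact max_le_add_of_nonneg (abs_nonneg _) (norm_nonneg _)
  · simpa using ((hD (t, x) ht).2 (0, w) (by simpa using ht)).2

end LipschitzField

end Sobolev

namespace Particle

open Sobolev

section Field

variable {E : ℝ × Plane → Plane}

theorem ae_norm_comp_inr_weakFDeriv_le (h : MemW1Inf spaceTime E) :
    ∀ᵐ q ∂volume.restrict spaceTime,
      ‖(weakFDeriv spaceTime E q).comp (inr ℝ ℝ Plane)‖ ≤ Kx E :=
  ae_norm_le_toReal (ne_top_of_le_ne_top h.memLp_weakFDeriv.2.ne
    (eLpNorm_mono fun _ => norm_comp_inr_le _))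

theorem exists_isLipschitzField_of_memW1Inf (hc : ContinuousOn E (Ici 0 ×ˢ univ))
    (h : MemW1Inf spaceTime E) : ∃ M, IsLipschitzField E M (Kx E) :=
  h.hasBoundedWeakFDerivOn.exists_isLipschitzField hc ENNReal.toReal_nonneg
    (ae_norm_comp_inr_weakFDeriv_le h)

theorem exists_isLipschitzDeriv_of_memW2Inf (hc : ContinuousOn E (Ici 0 ×ˢ univ))
    (h : MemW2Inf spaceTime E) : ∃ D Q, IsLipschitzDeriv E D (Kx E) Q :=
  h.memW1Inf.hasBoundedWeakFDerivOn.exists_isLipschitzDeriv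
    h.memW1Inf_weakFDeriv.hasBoundedWeakFDerivOn hc (ae_norm_comp_inr_weakFDeriv_le h.memW1Inf)

end Field

section Perp

theorem perp_add (v w : Plane) : perp (v + w) = perp v + perp w := by
  ext i; fin_cases i <;> simp [perp, add_comm]

theorem perp_smul (c : ℝ) (v : Plane) : perp (c • v) = c • perp v := by
  ext i; fin_cases i <;> simp [perp]

theorem perp_perp (v : Plane) : perp (perp v) = -v := by
  ext i; fin_cases i <;> simp [perp]

theorem norm_perp (v : Plane) : ‖perp v‖ = ‖v‖ := by
  simp [EuclideanSpace.norm_eq, Fin.sum_univ_two, perp, add_comm]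

/-- The quarter turn as a linear isometry, giving access to the library of linear maps. -/
def perpₗᵢ : Plane →ₗᵢ[ℝ] Plane where
  toFun := perp
  map_add' := perp_add
  map_smul' := perp_smul
  norm_map' := norm_perp

theorem perp_sub (v w : Plane) : perp (v - w) = perp v - perp w :=
  map_sub perpₗᵢ v w

theorem perp_sum {ι : Type*} (s : Finset ι) (f : ι → Plane) :
    perp (∑ i ∈ s, f i) = ∑ i ∈ s, perp (f i) :=
  map_sum perpₗᵢ f s

theorem hasDerivWithinAt_perp {f : ℝ → Plane} {f' : Plane} {s : Set ℝ} {t : ℝ}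
    (h : HasDerivWithinAt f f' s t) : HasDerivWithinAt (fun r => perp (f r)) (perp f') s t :=
  perpₗᵢ.toContinuousLinearMap.hasFDerivAt.comp_hasDerivWithinAt t h

theorem norm_add_smul_perp_sq (c : ℝ) (v : Plane) :
    ‖v + c • perp v‖ ^ 2 = (1 + c ^ 2) * ‖v‖ ^ 2 := by
  simp only [EuclideanSpace.norm_sq_eq, Fin.sum_univ_two, perp, PiLp.add_apply, PiLp.smul_apply,
    smul_eq_mul, Real.norm_eq_abs, sq_abs, Matrix.cons_val_zero, Matrix.cons_val_one,
    Matrix.cons_val_fin_one]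
  ring

theorem norm_le_norm_add_smul_perp (c : ℝ) (v : Plane) : ‖v‖ ≤ ‖v + c • perp v‖ := by
  refine (sq_le_sq₀ (norm_nonneg _) (norm_nonneg _)).1 ?_
  rw [norm_add_smul_perp_sq]
  exact le_mul_of_one_le_left (sq_nonneg _) (le_add_of_nonneg_right (sq_nonneg c))

/-- The solution operator of `w + c w^⊥ = b`. -/
def resolvent (c : ℝ) (b : Plane) : Plane := (1 + c ^ 2)⁻¹ • (b - c • perp b)

theorem add_smul_perp_eq_iff {c : ℝ} {b w : Plane} : w + c • perp w = b ↔ w = resolvent c b := by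
  have hc : 1 + c ^ 2 ≠ 0 := by positivity
  rw [resolvent, eq_inv_smul_iff₀ hc]
  constructor
  · rintro rfl
    rw [perp_add, perp_smul, perp_perp]
    module
  · intro h
    have hperp := congrArg perp h
    rw [perp_smul, perp_sub, perp_smul, perp_perp] at hperp
    refine smul_right_injective _ hc ?_
    simp only [smul_add, smul_comm (1 + c ^ 2) c, h, hperp]
    module

theorem norm_smul_perp {c : ℝ} (hc : 0 ≤ c) (v : Plane) : ‖c • perp v‖ = c * ‖v‖ := by
  rw [norm_smul, norm_perp, Real.norm_of_nonneg hc]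

end Perp

section Scheme

variable {E : ℝ × Plane → Plane} {ε Δt : ℝ} {x₀ v₀ : Plane} {xn vn : ℕ → Plane}

theorem scheme_position_iff (hΔ : 0 < Δt) {x y w : Plane} :
    Δt⁻¹ • (y - x) = ε⁻¹ • w ↔ y = x + (Δt / ε) • w := by
  rw [inv_smul_eq_iff₀ hΔ.ne', smul_smul, ← div_eq_mul_inv, sub_eq_iff_eq_add']

theorem scheme_velocity_iff (hε : 0 < ε) (hΔ : 0 < Δt) {v w e : Plane} :
    ε • (Δt⁻¹ • (w - v)) = e - ε⁻¹ • perp w ↔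
      w = resolvent (Δt / ε ^ 2) (v + (Δt / ε) • e) := by
  have h : (Δt / ε) • (ε • (Δt⁻¹ • (w - v)) - (e - ε⁻¹ • perp w)) =
      w + (Δt / ε ^ 2) • perp w - (v + (Δt / ε) • e) := by
    match_scalars <;> field_simp
  rw [← add_smul_perp_eq_iff, ← sub_eq_zero, ← sub_eq_zero (b := v + (Δt / ε) • e), ← h,
    smul_eq_zero_iff_right (by positivity)]

/-- The position and velocity produced from `p` by one step of the scheme at time `t`. -/
def schemeNext (E : ℝ × Plane → Plane) (ε Δt t : ℝ) (p : Plane × Plane) : Plane × Plane :=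
  let w := resolvent (Δt / ε ^ 2) (p.2 + (Δt / ε) • E (t, p.1))
  (p.1 + (Δt / ε) • w, w)

/-- The positions and velocities produced by the scheme. -/
def schemeSeq (E : ℝ × Plane → Plane) (ε Δt : ℝ) (x₀ v₀ : Plane) : ℕ → Plane × Plane
  | 0 => (x₀, v₀)
  | n + 1 => schemeNext E ε Δt (n * Δt) (schemeSeq E ε Δt x₀ v₀ n)

theorem existsUnique_isScheme (E : ℝ × Plane → Plane) (hε : 0 < ε) (hΔ : 0 < Δt)
    (x₀ v₀ : Plane) : ∃! s : (ℕ → Plane) × (ℕ → Plane), IsScheme E ε Δt x₀ v₀ s.1 s.2 := by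
  refine ⟨(fun n => (schemeSeq E ε Δt x₀ v₀ n).1, fun n => (schemeSeq E ε Δt x₀ v₀ n).2),
    ⟨rfl, rfl, fun n => (scheme_position_iff hΔ).2 rfl,
      fun n => (scheme_velocity_iff hε hΔ).2 rfl⟩, ?_⟩
  rintro ⟨xn, vn⟩ h
  have hseq n : (xn n, vn n) = schemeSeq E ε Δt x₀ v₀ n := by
    induction n with
    | zero => exact Prod.ext h.init_x h.init_v
    | succ n ih =>
      have hv := (scheme_velocity_iff hε hΔ).1 (h.step_v n)
      have hx := (scheme_position_iff hΔ).1 (h.step_x n)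
      rw [hv] at hx
      rw [schemeSeq, ← ih]
      exact Prod.ext hx hv
  exact Prod.ext (funext fun n => congrArg Prod.fst (hseq n))
    (funext fun n => congrArg Prod.snd (hseq n))

namespace IsScheme

theorem x_succ (h : IsScheme E ε Δt x₀ v₀ xn vn) (hΔ : 0 < Δt) (n : ℕ) :
    xn (n + 1) = xn n + (Δt / ε) • vn (n + 1) :=
  (scheme_position_iff hΔ).1 (h.step_x n)

theorem v_succ (h : IsScheme E ε Δt x₀ v₀ xn vn) (hε : 0 < ε) (hΔ : 0 < Δt) (n : ℕ) :
    vn (n + 1) + (Δt / ε ^ 2) • perp (vn (n + 1)) = vn n + (Δt / ε) • E (n * Δt, xn n) :=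
  add_smul_perp_eq_iff.2 ((scheme_velocity_iff hε hΔ).1 (h.step_v n))

theorem guidingCenter_succ (h : IsScheme E ε Δt x₀ v₀ xn vn) (hε : 0 < ε) (hΔ : 0 < Δt)
    (n : ℕ) : guidingCenter ε (xn (n + 1)) (vn (n + 1)) =
      guidingCenter ε (xn n) (vn n) - Δt • perp (E (n * Δt, xn n)) := by
  have hv := congrArg perp (h.v_succ hε hΔ n)
  rw [perp_add, perp_add, perp_smul, perp_smul, perp_perp, smul_neg, ← sub_eq_add_neg,
    sub_eq_iff_eq_add] at hv
  rw [guidingCenter, guidingCenter, h.x_succ hΔ n, hv]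
  match_scalars <;> field_simp
  ring

end IsScheme

end Scheme

section Gronwall

variable {a : ℕ → ℝ} {κ h b : ℝ} {N n : ℕ}

theorem cast_succ_mul_sub (n : ℕ) (h : ℝ) : ((n + 1 : ℕ) : ℝ) * h - n * h = h := by
  push_cast; ring

theorem one_add_mul_mul_exp_le (κ h : ℝ) (n : ℕ) :
    (1 + κ * h) * Real.exp (κ * (n * h)) ≤ Real.exp (κ * ((n + 1 : ℕ) * h)) := by
  grw [add_comm 1, Real.add_one_le_exp]
  rw [← Real.exp_add]
  refine (congrArg Real.exp ?_).le
  push_cast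
  ring

theorem le_of_le_one_add_mul (hκ : 0 ≤ κ) (hh : 0 ≤ h)
    (ha : ∀ n < N, a (n + 1) ≤ (1 + κ * h) * a n + h * (b * Real.exp (κ * ((n + 1 : ℕ) * h))))
    (ha₀ : 0 ≤ a 0) (hb : 0 ≤ b) (hn : n ≤ N) :
    a n ≤ (a 0 + n * h * b) * Real.exp (κ * (n * h)) := by
  induction n with
  | zero => simp
  | succ n ih =>
    set e : ℕ → ℝ := fun n => Real.exp (κ * (n * h))
    calc a (n + 1) ≤ (1 + κ * h) * ((a 0 + n * h * b) * e n) + h * (b * e (n + 1)) := by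
          grw [ha n (by omega), ih (by omega)]
      _ = (a 0 + n * h * b) * ((1 + κ * h) * e n) + h * (b * e (n + 1)) := by ring
      _ ≤ (a 0 + n * h * b) * e (n + 1) + h * (b * e (n + 1)) := by
          gcongr
          exact one_add_mul_mul_exp_le κ h n
      _ = (a 0 + (n + 1 : ℕ) * h * b) * e (n + 1) := by push_cast; ring

theorem le_of_le_sum_range {K : ℝ} (hK : 0 ≤ K) (hh : 0 ≤ h) (hb : 0 ≤ b)
    (ha : ∀ n ≤ N, a n ≤ b * Real.exp (2 * K * (n * h)) + K * h * ∑ k ∈ Finset.range n, a k)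
    (hn : n ≤ N) : a n ≤ 2 * b * Real.exp (2 * K * (n * h)) := by
  set e : ℕ → ℝ := fun n => Real.exp (2 * K * (n * h))
  have hgeom n : 2 * (K * h * ∑ k ∈ Finset.range n, e k) ≤ e n := by
    induction n with
    | zero => simp [e]
    | succ n ih =>
      rw [Finset.sum_range_succ]
      linarith [one_add_mul_mul_exp_le (2 * K) h n]
  induction n using Nat.strong_induction_on with
  | _ n ih =>
    have hsum : ∑ k ∈ Finset.range n, a k ≤ ∑ k ∈ Finset.range n, 2 * b * e k :=
      Finset.sum_le_sum fun k hk => ih k (Finset.mem_range.1 hk) (by grind)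
    calc a n ≤ b * e n + K * h * (2 * b * ∑ k ∈ Finset.range n, e k) := by
          grw [ha n hn, hsum, ← Finset.mul_sum]
      _ = b * e n + b * (2 * (K * h * ∑ k ∈ Finset.range n, e k)) := by ring
      _ ≤ b * e n + b * e n := by grw [hgeom n]
      _ = 2 * b * e n := by ring

end Gronwall

section Trajectory

variable {E : ℝ × Plane → Plane} {M K ε a b C R V s : ℝ} {x₀ v₀ e : Plane} {x v : ℝ → Plane}

theorem guidingCenter_sub (ε : ℝ) (x y v w : Plane) :
    guidingCenter ε x v - guidingCenter ε y w = (x - y) - ε • perp (v - w) := by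
  rw [guidingCenter, guidingCenter, perp_sub]
  module

theorem norm_sub_guidingCenter (hε : 0 ≤ ε) (x v : Plane) :
    ‖x - guidingCenter ε x v‖ = ε * ‖v‖ := by
  rw [guidingCenter, sub_sub_cancel, norm_smul_perp hε]

theorem norm_sub_le_of_hasDerivWithinAt_Ici {F : Type*} [NormedAddCommGroup F] [NormedSpace ℝ F]
    {f f' : ℝ → F} (ha : 0 ≤ a) (hab : a ≤ b)
    (hf : ∀ t, 0 ≤ t → HasDerivWithinAt f (f' t) (Ici 0) t) (hC : ∀ t ∈ Icc a b, ‖f' t‖ ≤ C) :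
    ‖f b - f a‖ ≤ C * (b - a) :=
  norm_image_sub_le_of_norm_deriv_le_segment'
    (fun t ht => (hf t (ha.trans ht.1)).mono fun _ hr => ha.trans hr.1)
    (fun t ht => hC t (Ico_subset_Icc_self ht)) b (right_mem_Icc.2 hab)

namespace IsTrajectory

theorem hasDerivWithinAt_guidingCenter (h : IsTrajectory E ε x₀ v₀ x v) (hε : 0 < ε) {t : ℝ}
    (ht : 0 ≤ t) :
    HasDerivWithinAt (fun s => guidingCenter ε (x s) (v s)) (-perp (E (t, x t))) (Ici 0) t := by
  refine ((h.deriv_x t ht).sub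
    ((hasDerivWithinAt_perp (h.deriv_v t ht)).const_smul ε)).congr_deriv ?_
  rw [perp_smul, perp_sub, perp_smul, perp_perp]
  match_scalars <;> field_simp
  ring

theorem norm_position_sub_le (h : IsTrajectory E ε x₀ v₀ x v) (hε : 0 < ε) (ha : 0 ≤ a)
    (hab : a ≤ b) (hV : ∀ s ∈ Icc a b, ‖v s‖ ≤ V) : ‖x b - x a‖ ≤ V / ε * (b - a) := by
  refine norm_sub_le_of_hasDerivWithinAt_Ici ha hab h.deriv_x fun t ht => ?_
  rw [norm_smul, norm_inv, Real.norm_of_nonneg hε.le, inv_mul_eq_div]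
  grw [hV t ht]

theorem norm_velocity_sub_le (h : IsTrajectory E ε x₀ v₀ x v) (hE : IsLipschitzField E M K)
    (hε : 0 < ε) (ha : 0 ≤ a) (hab : a ≤ b) (hV : ∀ s ∈ Icc a b, ‖v s‖ ≤ V) :
    ‖v b - v a‖ ≤ (M + V / ε) / ε * (b - a) := by
  refine norm_sub_le_of_hasDerivWithinAt_Ici ha hab h.deriv_v fun t ht => ?_
  rw [norm_smul, norm_inv, Real.norm_of_nonneg hε.le, inv_mul_eq_div]
  grw [norm_sub_le, hE.norm_le _ (ha.trans ht.1), norm_smul, norm_inv, norm_perp, hV t ht,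
    Real.norm_of_nonneg hε.le, inv_mul_eq_div]

theorem norm_guidingCenter_step_le (h : IsTrajectory E ε x₀ v₀ x v) (hε : 0 < ε) (ha : 0 ≤ a)
    (hab : a ≤ b) (hC : ∀ s ∈ Icc a b, ‖E (s, x s) - e‖ ≤ C) :
    ‖guidingCenter ε (x b) (v b) - guidingCenter ε (x a) (v a) + (b - a) • perp e‖ ≤
      C * (b - a) := by
  have hderiv t (ht : 0 ≤ t) : HasDerivWithinAt (fun s => guidingCenter ε (x s) (v s) + s • perp e)
      (-perp (E (t, x t) - e)) (Ici 0) t := by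
    refine ((h.hasDerivWithinAt_guidingCenter hε ht).fun_add
      ((hasDerivWithinAt_id t _).smul_const (perp e))).congr_deriv ?_
    rw [perp_sub]
    module
  have hstep := norm_sub_le_of_hasDerivWithinAt_Ici ha hab hderiv
    fun t ht => by simpa only [norm_neg, norm_perp] using hC t ht
  rwa [add_sub_add_comm, ← sub_smul] at hstep

theorem norm_velocity_step_le (h : IsTrajectory E ε x₀ v₀ x v) (hε : 0 < ε) (ha : 0 ≤ a)
    (hab : a ≤ b) (hC : ∀ s ∈ Icc a b, ‖E (s, x s) - e‖ ≤ C)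
    (hR : ∀ s ∈ Icc a b, ‖v b - v s‖ ≤ R) :
    ‖v b + ((b - a) / ε ^ 2) • perp (v b) - (v a + ((b - a) / ε) • e)‖ ≤
      (C + R / ε) / ε * (b - a) := by
  have hderiv t (ht : 0 ≤ t) :
      HasDerivWithinAt (fun s => v s + (s / ε ^ 2) • perp (v b) - (s / ε) • e)
        (ε⁻¹ • (E (t, x t) - e + ε⁻¹ • perp (v b - v t))) (Ici 0) t := by
    refine (((h.deriv_v t ht).fun_add (((hasDerivWithinAt_id t _).div_const (ε ^ 2)).smul_const
      (perp (v b)))).fun_sub (((hasDerivWithinAt_id t _).div_const ε).smul_const e)).congr_deriv ?_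
    rw [perp_sub]
    match_scalars <;> field_simp
  have hstep := norm_sub_le_of_hasDerivWithinAt_Ici ha hab hderiv (C := (C + R / ε) / ε) ?_
  · refine (congrArg norm ?_).trans_le hstep
    module
  · intro t ht
    rw [norm_smul, norm_inv, Real.norm_of_nonneg hε.le, inv_mul_eq_div]
    grw [norm_add_le, hC t ht, norm_smul, norm_inv, norm_perp, hR t ht, Real.norm_of_nonneg hε.le,
      inv_mul_eq_div]

theorem norm_field_sub_le (h : IsTrajectory E ε x₀ v₀ x v) (hE : IsLipschitzField E M K)
    (hε : 0 < ε) (ha : 0 ≤ a) (hV : ∀ s ∈ Icc a b, ‖v s‖ ≤ V) (hs : s ∈ Icc a b) (z : Plane) :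
    ‖E (s, x s) - E (a, z)‖ ≤ M * (b - a) + K * (V / ε * (b - a) + ‖z - x a‖) := by
  have hM := hE.bound_nonneg
  have hK := hE.space_nonneg
  have hV₀ : 0 ≤ V := (norm_nonneg _).trans (hV s hs)
  have hx : ‖x s - z‖ ≤ V / ε * (s - a) + ‖z - x a‖ := by
    grw [← h.norm_position_sub_le hε ha hs.1 fun r hr => hV r ⟨hr.1, hr.2.trans hs.2⟩,
      norm_sub_rev z, ← norm_sub_le_norm_sub_add_norm_sub]
  grw [hE.norm_sub_le _ _ ha (ha.trans hs.1), hx, abs_of_nonneg (sub_nonneg.2 hs.1), hs.2]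

end IsTrajectory

end Trajectory

section ClassicalError

variable {E : ℝ × Plane → Plane} {M K ε Δt A V : ℝ} {x₀ v₀ : Plane} {x v : ℝ → Plane}
  {xn vn : ℕ → Plane} {n N : ℕ}

/-- The distance between two points of phase space used to compare the scheme with the
trajectory: measuring the guiding centers instead of the positions avoids inverse powers of `ε` in
the growth rate of the error. -/
def phaseDist (ε : ℝ) (x v y w : Plane) : ℝ :=
  ‖guidingCenter ε x v - guidingCenter ε y w‖ + ε * ‖v - w‖

theorem norm_sub_le_phaseDist (hε : 0 ≤ ε) (x v y w : Plane) : ‖x - y‖ ≤ phaseDist ε x v y w := by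
  have h : x - y = (guidingCenter ε x v - guidingCenter ε y w) + ε • perp (v - w) := by
    rw [guidingCenter_sub, sub_add_cancel]
  rw [h, phaseDist, ← norm_smul_perp hε]
  exact norm_add_le _ _

theorem phaseDist_succ_le (hE : IsLipschitzField E M K) (hε : 0 < ε) (hΔ : 0 < Δt)
    (ht : IsTrajectory E ε x₀ v₀ x v) (hs : IsScheme E ε Δt x₀ v₀ xn vn)
    (hV : ∀ s ∈ Icc (n * Δt) ((n + 1 : ℕ) * Δt), ‖v s‖ ≤ V) :
    phaseDist ε (xn (n + 1)) (vn (n + 1)) (x ((n + 1 : ℕ) * Δt)) (v ((n + 1 : ℕ) * Δt)) ≤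
      (1 + 2 * K * Δt) * phaseDist ε (xn n) (vn n) (x (n * Δt)) (v (n * Δt)) +
        Δt * (Δt * (2 * M + 2 * K * V / ε + M / ε ^ 2 + V / ε ^ 3)) := by
  have hK := hE.space_nonneg
  have ha : 0 ≤ n * Δt := by positivity
  have hba := cast_succ_mul_sub n Δt
  set a := n * Δt
  set b := ((n + 1 : ℕ) : ℝ) * Δt
  have hab : a ≤ b := by linarith
  set p := phaseDist ε (xn n) (vn n) (x a) (v a) with hp
  have hV₀ : 0 ≤ V := (norm_nonneg _).trans (hV a (left_mem_Icc.2 hab))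
  have hM := hE.bound_nonneg
  have hfield : ∀ s ∈ Icc a b, ‖E (s, x s) - E (a, xn n)‖ ≤ M * Δt + K * (V / ε * Δt + p) :=
    fun s hs => by
      grw [ht.norm_field_sub_le hE hε ha hV hs, norm_sub_le_phaseDist hε.le _ (vn n) _ (v a), hba]
  set C := M * Δt + K * (V / ε * Δt + p)
  have hvel : ∀ s ∈ Icc a b, ‖v b - v s‖ ≤ (M + V / ε) / ε * Δt := fun s hs => by
    grw [ht.norm_velocity_sub_le hE hε (ha.trans hs.1) hs.2
      fun r hr => hV r ⟨hs.1.trans hr.1, hr.2⟩, ← hba, hs.1]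
  have hy : ‖guidingCenter ε (xn (n + 1)) (vn (n + 1)) - guidingCenter ε (x b) (v b)‖ ≤
      ‖guidingCenter ε (xn n) (vn n) - guidingCenter ε (x a) (v a)‖ + C * Δt := by
    have hstep := ht.norm_guidingCenter_step_le hε ha hab hfield
    rw [hba] at hstep
    grw [← hstep, ← norm_sub_le, hs.guidingCenter_succ hε hΔ n]
    exact (congrArg norm (by module)).le
  have hv : ‖vn (n + 1) - v b‖ ≤
      ‖vn n - v a‖ + (C + (M + V / ε) / ε * Δt / ε) / ε * Δt := by
    have hstep := ht.norm_velocity_step_le hε ha hab hfield hvel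
    rw [hba] at hstep
    grw [← hstep, ← norm_sub_le, norm_le_norm_add_smul_perp (Δt / ε ^ 2), perp_sub,
      smul_sub, ← add_sub_add_comm, hs.v_succ hε hΔ n]
    exact (congrArg norm (by module)).le
  calc _ ≤ ‖guidingCenter ε (xn n) (vn n) - guidingCenter ε (x a) (v a)‖ + C * Δt +
        ε * (‖vn n - v a‖ + (C + (M + V / ε) / ε * Δt / ε) / ε * Δt) := by
          rw [phaseDist]; gcongr
    _ = p + (C * Δt + (C + (M + V / ε) / ε * Δt / ε) * Δt) := by
          rw [hp, phaseDist]; field_simp; ring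
    _ = _ := by simp only [C]; field_simp; ring

theorem phaseDist_le (hE : IsLipschitzField E M K) (hε : 0 < ε) (hΔ : 0 < Δt)
    (ht : IsTrajectory E ε x₀ v₀ x v) (hs : IsScheme E ε Δt x₀ v₀ xn vn)
    (hA : ∀ s ∈ Icc 0 (N * Δt), ‖v s‖ ≤ A * Real.exp (K * s)) :
    phaseDist ε (xn N) (vn N) (x (N * Δt)) (v (N * Δt)) ≤
      N * Δt * (Δt * (2 * M + 2 * K * A / ε + M / ε ^ 2 + A / ε ^ 3)) *
        Real.exp (2 * K * (N * Δt)) := by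
  have hM := hE.bound_nonneg
  have hK := hE.space_nonneg
  have hA₀ : 0 ≤ A := by
    simpa using (norm_nonneg _).trans (hA 0 (left_mem_Icc.2 (by positivity)))
  set B := 2 * M + 2 * K * A / ε + M / ε ^ 2 + A / ε ^ 3
  let p n := phaseDist ε (xn n) (vn n) (x (n * Δt)) (v (n * Δt))
  have hp₀ : p 0 = 0 := by
    simp [p, phaseDist, ht.init_x, ht.init_v, hs.init_x, hs.init_v]
  have hstep : ∀ n < N, p (n + 1) ≤ (1 + 2 * K * Δt) * p n +
      Δt * (Δt * B * Real.exp (2 * K * ((n + 1 : ℕ) * Δt))) := fun n hn => by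
    set b := ((n + 1 : ℕ) : ℝ) * Δt
    have : 0 ≤ b := by positivity
    have hbN : b ≤ N * Δt := mul_le_mul_of_nonneg_right (by exact_mod_cast hn) hΔ.le
    have hV : ∀ s ∈ Icc (n * Δt) b, ‖v s‖ ≤ A * Real.exp (2 * K * b) := fun s hs => by
      have hs₀ : 0 ≤ s := (by positivity : 0 ≤ n * Δt).trans hs.1
      refine (hA s ⟨hs₀, hs.2.trans hbN⟩).trans ?_
      gcongr
      · linarith
      · exact hs.2
    have hexp : 1 ≤ Real.exp (2 * K * b) := Real.one_le_exp (by positivity)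
    have hB : 2 * M + 2 * K * (A * Real.exp (2 * K * b)) / ε + M / ε ^ 2 +
        A * Real.exp (2 * K * b) / ε ^ 3 ≤ B * Real.exp (2 * K * b) := by
      have : 0 ≤ (2 * M + M / ε ^ 2) * (Real.exp (2 * K * b) - 1) :=
        mul_nonneg (by positivity) (sub_nonneg.2 hexp)
      linear_combination this
    grw [mul_assoc Δt B, ← hB]
    exact phaseDist_succ_le hE hε hΔ ht hs hV
  simpa [hp₀] using le_of_le_one_add_mul (by positivity) hΔ.le hstep hp₀.ge (by positivity) le_rfl

end ClassicalError

section VelocityBound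

variable {E : ℝ × Plane → Plane} {M K ε Δt : ℝ} {x₀ v₀ : Plane} {x v : ℝ → Plane}
  {xn vn : ℕ → Plane}

/-- The factor of `velocityBound` that depends only on the bounds for the field. -/
def velocityConst (M K : ℝ) : ℝ := 1 + 2 * M * (1 + K)

/-- The prefactor of `e^{K t}` in the bound for the velocities, of the scheme and of the
trajectory, on the time interval `[0, t]`. -/
def velocityBound (M K ε : ℝ) (v₀ : Plane) (t : ℝ) : ℝ :=
  velocityConst M K * (1 + t) * (‖v₀‖ + ε)

theorem norm_smul_perp_field_le (hE : IsLipschitzField E M K) (hε : 0 ≤ ε) {t : ℝ} (ht : 0 ≤ t)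
    (z : Plane) : ‖ε • perp (E (t, z))‖ ≤ ε * M := by
  grw [norm_smul_perp hε, hE.norm_le z ht]

namespace IsScheme

theorem norm_add_smul_perp_field_le (h : IsScheme E ε Δt x₀ v₀ xn vn) (hε : 0 < ε) (hΔ : 0 < Δt)
    (n : ℕ) :
    ‖vn (n + 1) + ε • perp (E (n * Δt, xn n))‖ ≤ ‖vn n + ε • perp (E (n * Δt, xn n))‖ := by
  refine (norm_le_norm_add_smul_perp (Δt / ε ^ 2) _).trans_eq (congrArg norm ?_)
  rw [perp_add, perp_smul, perp_perp, smul_add, add_add_add_comm, h.v_succ hε hΔ n]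
  match_scalars <;> field_simp
  ring

theorem norm_velocity_succ_le (h : IsScheme E ε Δt x₀ v₀ xn vn) (hE : IsLipschitzField E M K)
    (hε : 0 < ε) (hΔ : 0 < Δt) (n : ℕ) :
    ‖vn (n + 1)‖ ≤ ‖vn n + ε • perp (E (n * Δt, xn n))‖ + ε * M := by
  grw [← h.norm_add_smul_perp_field_le hε hΔ, ← norm_smul_perp_field_le hE hε.le
    (by positivity : 0 ≤ n * Δt) (xn n)]
  exact norm_le_add_norm_add _ _

theorem norm_add_smul_perp_field_succ_le (h : IsScheme E ε Δt x₀ v₀ xn vn)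
    (hE : IsLipschitzField E M K) (hε : 0 < ε) (hΔ : 0 < Δt) (n : ℕ) :
    ‖vn (n + 1) + ε • perp (E ((n + 1 : ℕ) * Δt, xn (n + 1)))‖ ≤
      (1 + K * Δt) * ‖vn n + ε • perp (E (n * Δt, xn n))‖ + Δt * (ε * M * (1 + K)) := by
  have hK := hE.space_nonneg
  have hfield : ‖ε • perp (E ((n + 1 : ℕ) * Δt, xn (n + 1)) - E (n * Δt, xn n))‖ ≤
      ε * (M * Δt + K * (Δt / ε * (‖vn n + ε • perp (E (n * Δt, xn n))‖ + ε * M))) := by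
    rw [norm_smul_perp hε.le]
    grw [hE.norm_sub_le _ _ (by positivity) (by positivity), ← h.norm_velocity_succ_le hE hε hΔ n]
    rw [h.x_succ hΔ n, add_sub_cancel_left, norm_smul, Real.norm_of_nonneg (by positivity),
      cast_succ_mul_sub, abs_of_pos hΔ]
  calc
    _ ≤ ‖vn (n + 1) + ε • perp (E (n * Δt, xn n))‖ +
        ‖ε • perp (E ((n + 1 : ℕ) * Δt, xn (n + 1)) - E (n * Δt, xn n))‖ := by
      grw [← norm_add_le]
      rw [perp_sub]
      exact (congrArg norm (by module)).le
    _ ≤ _ := add_le_add (h.norm_add_smul_perp_field_le hε hΔ n) hfield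
    _ = _ := by field_simp; ring

theorem norm_velocity_le (h : IsScheme E ε Δt x₀ v₀ xn vn) (hE : IsLipschitzField E M K)
    (hε : 0 < ε) (hΔ : 0 < Δt) (n : ℕ) :
    ‖vn n‖ ≤ velocityBound M K ε v₀ (n * Δt) * Real.exp (K * (n * Δt)) := by
  have hM := hE.bound_nonneg
  have hK := hE.space_nonneg
  have hfield (m : ℕ) := norm_smul_perp_field_le hE hε.le (by positivity : 0 ≤ m * Δt) (xn m)
  let u (m : ℕ) : Plane := vn m + ε • perp (E (m * Δt, xn m))
  have hstep : ∀ m < n, ‖u (m + 1)‖ ≤ (1 + K * Δt) * ‖u m‖ +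
      Δt * (ε * M * (1 + K) * Real.exp (K * ((m + 1 : ℕ) * Δt))) := fun m _ => by
    refine (h.norm_add_smul_perp_field_succ_le hE hε hΔ m).trans
      (add_le_add le_rfl (mul_le_mul_of_nonneg_left ?_ hΔ.le))
    exact le_mul_of_one_le_right (by positivity) (Real.one_le_exp (by positivity))
  have hu := le_of_le_one_add_mul (a := fun m => ‖u m‖) hK hΔ.le hstep (norm_nonneg _)
    (by positivity) le_rfl
  have hu₀ : ‖u 0‖ ≤ ‖v₀‖ + ε * M := by grw [norm_add_le, hfield 0, h.init_v]
  have : 0 ≤ n * Δt := by positivity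
  have hexp : 1 ≤ Real.exp (K * (n * Δt)) := Real.one_le_exp (by positivity)
  calc ‖vn n‖ ≤ ‖u n‖ + ε * M := by
        grw [← hfield n]
        exact norm_le_add_norm_add _ _
    _ ≤ (‖v₀‖ + ε * M + n * Δt * (ε * M * (1 + K))) * Real.exp (K * (n * Δt)) +
        ε * M * Real.exp (K * (n * Δt)) := by
        grw [hu, hu₀]
        exact add_le_add le_rfl (le_mul_of_one_le_right (by positivity) hexp)
    _ = (‖v₀‖ + ε * (2 * M + n * Δt * (M * (1 + K)))) * Real.exp (K * (n * Δt)) := by ring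
    _ ≤ _ := by
        gcongr
        have : 0 ≤ ‖v₀‖ * (n * Δt + 2 * M * (1 + K) * (1 + n * Δt)) + ε * (1 + n * Δt) +
          ε * M * (2 * K + n * Δt * (1 + K)) := by positivity
        rw [velocityBound, velocityConst]
        linear_combination this

end IsScheme

/-- The bound is inherited from the scheme, in the limit `Δt → 0` at fixed `ε`. -/
theorem IsTrajectory.norm_velocity_le (h : IsTrajectory E ε x₀ v₀ x v)
    (hE : IsLipschitzField E M K) (hε : 0 < ε) {t : ℝ} (ht : 0 ≤ t) :
    ‖v t‖ ≤ velocityBound M K ε v₀ t * Real.exp (K * t) := by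
  have hM := hE.bound_nonneg
  have hK := hE.space_nonneg
  obtain rfl | ht := ht.eq_or_lt
  · have : 0 ≤ 2 * M * (1 + K) * ‖v₀‖ + (1 + 2 * M * (1 + K)) * ε := by positivity
    rw [h.init_v, velocityBound, velocityConst, mul_zero, Real.exp_zero]
    linear_combination this
  obtain ⟨A, hA⟩ := isCompact_Icc.exists_bound_of_continuousOn (s := Icc 0 t) (f := v)
    fun s hs => ((h.deriv_v s hs.1).continuousWithinAt).mono Icc_subset_Ici_self
  have hA₀ : 0 ≤ A := (norm_nonneg _).trans (hA 0 (left_mem_Icc.2 ht.le))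
  set B := 2 * M + 2 * K * A / ε + M / ε ^ 2 + A / ε ^ 3
  have happrox (j : ℕ) : ‖v t‖ ≤ velocityBound M K ε v₀ t * Real.exp (K * t) +
      1 / (j + 1) * (t ^ 2 * B * Real.exp (2 * K * t) / ε) := by
    have hΔ : 0 < t / (j + 1) := by positivity
    obtain ⟨⟨xn, vn⟩, hs, -⟩ := existsUnique_isScheme E hε hΔ x₀ v₀
    have hN : ((j + 1 : ℕ) : ℝ) * (t / (j + 1)) = t := by push_cast; field_simp
    have hscheme := hs.norm_velocity_le hE hε hΔ (j + 1)
    have herror := phaseDist_le (N := j + 1) (A := A) hE hε hΔ h hs fun s hs => by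
      rw [hN] at hs
      exact (hA s hs).trans (le_mul_of_one_le_right hA₀
        (Real.one_le_exp (mul_nonneg hK hs.1)))
    rw [hN] at hscheme herror
    have hdist : ε * ‖vn (j + 1) - v t‖ ≤ t * (t / (j + 1) * B) * Real.exp (2 * K * t) :=
      (le_add_of_nonneg_left (norm_nonneg _)).trans herror
    rw [mul_comm, ← le_div_iff₀ hε] at hdist
    calc ‖v t‖ ≤ ‖vn (j + 1)‖ + ‖vn (j + 1) - v t‖ := norm_le_norm_add_norm_sub _ _
      _ ≤ _ := add_le_add hscheme hdist
      _ = _ := by ring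
  have hlim := ((tendsto_one_div_add_atTop_nhds_zero_nat (𝕜 := ℝ)).mul_const
    (t ^ 2 * B * Real.exp (2 * K * t) / ε)).const_add
    (velocityBound M K ε v₀ t * Real.exp (K * t))
  rw [zero_mul, add_zero] at hlim
  exact ge_of_tendsto' hlim happrox

end VelocityBound

section DriftDefect

variable {E : ℝ × Plane → Plane} {D : ℝ × Plane → Plane →L[ℝ] Plane} {M K Q h b r U : ℝ}
  {y z u : ℕ → Plane} {n N : ℕ}

/-- The accumulated failure, over the first `n` steps, of the sequence `y` to follow the explicit
Euler scheme with time step `h` for the limit equation `y' = -E(t, y)^⊥` of the guiding center. -/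
def driftDefect (E : ℝ × Plane → Plane) (h : ℝ) (y : ℕ → Plane) (n : ℕ) : Plane :=
  ∑ k ∈ Finset.range n, (y (k + 1) - y k + h • perp (E (k * h, y k)))

theorem norm_driftDefect_le (hr : ∀ k < n, ‖y (k + 1) - y k + h • perp (E (k * h, y k))‖ ≤ h * r) :
    ‖driftDefect E h y n‖ ≤ n * h * r :=
  (norm_sum_le_of_le _ fun k hk => hr k (Finset.mem_range.1 hk)).trans_eq (by simp [mul_assoc])

theorem norm_sub_le_of_norm_driftDefect_le (hE : IsLipschitzField E M K) (hh : 0 ≤ h) (hb : 0 ≤ b)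
    (hyz : y 0 = z 0)
    (hdefect : ∀ n ≤ N, ‖driftDefect E h y n‖ + ‖driftDefect E h z n‖ ≤
      b * Real.exp (2 * K * (n * h))) :
    ‖y N - z N‖ ≤ 2 * b * Real.exp (2 * K * (N * h)) := by
  refine le_of_le_sum_range (a := fun n => ‖y n - z n‖) hE.space_nonneg hh hb
    (fun n hn => ?_) le_rfl
  have hsplit : y n - z n = driftDefect E h y n - driftDefect E h z n -
      ∑ k ∈ Finset.range n, h • perp (E (k * h, y k) - E (k * h, z k)) := by
    have htele := Finset.sum_range_sub (fun k => y k - z k) n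
    rw [hyz, sub_self, sub_zero] at htele
    rw [driftDefect, driftDefect, ← htele, ← Finset.sum_sub_distrib, ← Finset.sum_sub_distrib]
    refine Finset.sum_congr rfl fun k _ => ?_
    rw [perp_sub]
    module
  have hfield : ‖∑ k ∈ Finset.range n, h • perp (E (k * h, y k) - E (k * h, z k))‖ ≤
      K * h * ∑ k ∈ Finset.range n, ‖y k - z k‖ := by
    rw [Finset.mul_sum]
    refine norm_sum_le_of_le _ fun k _ => ?_
    have hk : 0 ≤ k * h := by positivity
    have hE' := hE.norm_sub_le (y k) (z k) hk hk
    rw [sub_self, abs_zero, mul_zero, zero_add] at hE'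
    rw [norm_smul_perp hh, mul_comm K, mul_assoc]
    gcongr
  rw [hsplit]
  grw [norm_sub_le, norm_sub_le, hdefect n hn, hfield]

theorem norm_sum_range_apply_sub_le {V W : Type*} [NormedAddCommGroup V] [NormedSpace ℝ V]
    [NormedAddCommGroup W] [NormedSpace ℝ W] {L : ℕ → V →L[ℝ] W} {u : ℕ → V} {κ ρ B : ℝ}
    (hL : ∀ k ≤ n, ‖L k‖ ≤ κ) (hLsub : ∀ k < n, ‖L (k + 1) - L k‖ ≤ ρ)
    (hu : ∀ k ≤ n, ‖u k‖ ≤ B) :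
    ‖∑ k ∈ Finset.range n, L k (u (k + 1) - u k)‖ ≤ (2 * κ + n * ρ) * B := by
  have habel : ∑ k ∈ Finset.range n, L k (u (k + 1) - u k) =
      L n (u n) - L 0 (u 0) - ∑ k ∈ Finset.range n, (L (k + 1) - L k) (u (k + 1)) := by
    rw [← Finset.sum_range_sub (fun k => L k (u k)), ← Finset.sum_sub_distrib]
    refine Finset.sum_congr rfl fun k _ => ?_
    rw [map_sub, sub_apply]
    abel
  have hend k (hk : k ≤ n) : ‖L k (u k)‖ ≤ κ * B := (L k).le_of_opNorm_le_of_le (hL k hk) (hu k hk)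
  have hsum : ‖∑ k ∈ Finset.range n, (L (k + 1) - L k) (u (k + 1))‖ ≤ n * (ρ * B) := by
    refine (norm_sum_le_of_le _ fun k hk => ?_).trans_eq
      (by rw [Finset.sum_const, Finset.card_range, nsmul_eq_mul])
    have hk := Finset.mem_range.1 hk
    exact (L (k + 1) - L k).le_of_opNorm_le_of_le (hLsub k hk) (hu _ hk)
  rw [habel]
  grw [norm_sub_le, norm_sub_le, hend n le_rfl, hend 0 n.zero_le, hsum]
  exact (by ring : _ = _).le

/-- The fast oscillation enters each step as `D (u (k + 1) - u k)`, so it does not accumulate. -/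
theorem norm_driftDefect_le_of_oscillation (hD : IsLipschitzDeriv E D K Q) (hh : 0 ≤ h)
    (hy : ∀ k < n, ‖y (k + 1) - y k‖ ≤ M * h) (hu : ∀ k ≤ n, ‖u k‖ ≤ U)
    (hr : ∀ k < n, ‖y (k + 1) - y k + h • perp (E (k * h, y k)) -
      perp (D (k * h, y k) (u (k + 1) - u k))‖ ≤ h * r) :
    ‖driftDefect E h y n‖ ≤ n * h * r + (2 * K + n * h * (Q * (1 + M))) * U := by
  have hD' k (hk : k < n) :
      ‖D ((k + 1 : ℕ) * h, y (k + 1)) - D (k * h, y k)‖ ≤ h * (Q * (1 + M)) := by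
    have := hD.nonneg
    grw [hD.norm_sub_le _ _ (by positivity) (by positivity), hy k hk]
    rw [cast_succ_mul_sub, abs_of_nonneg hh]
    exact (by ring : _ = _).le
  have hosc := norm_sum_range_apply_sub_le (L := fun k => D (k * h, y k))
    (fun k _ => hD.norm_le _ (by positivity)) hD' hu
  have hrem := norm_sum_le_of_le _ fun k (hk : k ∈ Finset.range n) => hr k (Finset.mem_range.1 hk)
  rw [Finset.sum_sub_distrib, ← perp_sum, Finset.sum_const, Finset.card_range, nsmul_eq_mul,
    ← mul_assoc] at hrem
  rw [← mul_assoc] at hosc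
  rw [← norm_perp] at hosc
  exact (norm_le_norm_sub_add _ _).trans (add_le_add hrem hosc)

end DriftDefect

section GuidingCenterError

variable {E : ℝ × Plane → Plane} {D : ℝ × Plane → Plane →L[ℝ] Plane}
  {M K Q ε Δt A B V a b : ℝ} {x₀ v₀ : Plane} {x v : ℝ → Plane} {xn vn : ℕ → Plane} {n N : ℕ}

theorem norm_field_sub_guidingCenter_le (hE : IsLipschitzField E M K) (hε : 0 ≤ ε) {t : ℝ}
    (ht : 0 ≤ t) (x v : Plane) :
    ‖E (t, x) - E (t, guidingCenter ε x v)‖ ≤ K * (ε * ‖v‖) := by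
  refine (hE.norm_sub_le _ _ ht ht).trans_eq ?_
  rw [sub_self, abs_zero, mul_zero, zero_add, norm_sub_guidingCenter hε]

theorem norm_taylor_guidingCenter_le (hD : IsLipschitzDeriv E D K Q) (hε : 0 ≤ ε) {t : ℝ}
    (ht : 0 ≤ t) (x v : Plane) :
    ‖E (t, x) - E (t, guidingCenter ε x v) - D (t, guidingCenter ε x v) (ε • perp v)‖ ≤
      Q * (ε * ‖v‖) ^ 2 := by
  have htaylor := hD.taylor (guidingCenter ε x v) (ε • perp v) ht
  rwa [norm_smul_perp hε, guidingCenter, sub_add_cancel] at htaylor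

namespace IsScheme

theorem norm_guidingCenter_sub_le (h : IsScheme E ε Δt x₀ v₀ xn vn) (hE : IsLipschitzField E M K)
    (hε : 0 < ε) (hΔ : 0 < Δt) (n : ℕ) :
    ‖guidingCenter ε (xn (n + 1)) (vn (n + 1)) - guidingCenter ε (xn n) (vn n)‖ ≤ M * Δt := by
  rw [h.guidingCenter_succ hε hΔ n, sub_sub_cancel_left, norm_neg, norm_smul_perp hΔ.le, mul_comm]
  grw [hE.norm_le _ (by positivity)]

theorem norm_driftDefect_le (h : IsScheme E ε Δt x₀ v₀ xn vn) (hE : IsLipschitzField E M K)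
    (hε : 0 < ε) (hΔ : 0 < Δt) (hV : ∀ k ≤ n, ‖vn k‖ ≤ V) :
    ‖driftDefect E Δt (fun k => guidingCenter ε (xn k) (vn k)) n‖ ≤ n * Δt * (K * (ε * V)) := by
  refine Particle.norm_driftDefect_le fun k hk => ?_
  have hstep : guidingCenter ε (xn (k + 1)) (vn (k + 1)) - guidingCenter ε (xn k) (vn k) +
      Δt • perp (E (k * Δt, guidingCenter ε (xn k) (vn k))) =
      -(Δt • perp (E (k * Δt, xn k) - E (k * Δt, guidingCenter ε (xn k) (vn k)))) := by
    rw [h.guidingCenter_succ hε hΔ k, perp_sub]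
    module
  have hK := hE.space_nonneg
  rw [hstep, norm_neg, norm_smul_perp hΔ.le]
  grw [norm_field_sub_guidingCenter_le hE hε.le (by positivity), hV k hk.le]

/-- The total difference consumes the first-order Taylor term `Δt D (ε v_n^⊥)` of the field, because
the scheme reads `(ε³ v_{n+1} + Δt ε v_{n+1}^⊥) - ε³ v_n = ε² Δt E(t_n, x_n)`. -/
theorem norm_guidingCenter_expansion_le (h : IsScheme E ε Δt x₀ v₀ xn vn)
    (hE : IsLipschitzField E M K) (hD : IsLipschitzDeriv E D K Q) (hε : 0 < ε) (hΔ : 0 < Δt)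
    (hV : ‖vn n‖ ≤ V) :
    ‖guidingCenter ε (xn (n + 1)) (vn (n + 1)) - guidingCenter ε (xn n) (vn n) +
        Δt • perp (E (n * Δt, guidingCenter ε (xn n) (vn n))) -
        perp (D (n * Δt, guidingCenter ε (xn n) (vn n))
          ((ε ^ 3 • vn (n + 1) + (Δt * ε) • perp (vn (n + 1))) -
            (ε ^ 3 • vn n + (Δt * ε) • perp (vn n))))‖ ≤
      Δt * (Q * (ε * V) ^ 2 + ε ^ 2 * (K * M)) := by
  have ht : 0 ≤ n * Δt := by positivity
  have := hE.space_nonneg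
  have hQ := hD.nonneg
  have hdiff : (ε ^ 3 • vn (n + 1) + (Δt * ε) • perp (vn (n + 1))) -
      (ε ^ 3 • vn n + (Δt * ε) • perp (vn n)) =
      Δt • (ε ^ 2 • E (n * Δt, xn n) - ε • perp (vn n)) := by
    have hv := congrArg (ε ^ 3 • ·) (eq_sub_of_add_eq (h.v_succ hε hΔ n))
    rw [hv]
    match_scalars <;> field_simp <;> ring
  rw [hdiff, h.guidingCenter_succ hε hΔ n]
  set y := guidingCenter ε (xn n) (vn n)
  set L := D (n * Δt, y)
  have hstep : y - Δt • perp (E (n * Δt, xn n)) - y + Δt • perp (E (n * Δt, y)) -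
      perp (L (Δt • (ε ^ 2 • E (n * Δt, xn n) - ε • perp (vn n)))) =
      -(Δt • perp ((E (n * Δt, xn n) - E (n * Δt, y) - L (ε • perp (vn n))) +
        ε ^ 2 • L (E (n * Δt, xn n)))) := by
    simp only [map_smul, map_sub, perp_add, perp_sub, perp_smul]
    module
  rw [hstep, norm_neg, norm_smul_perp hΔ.le]
  grw [norm_add_le, norm_taylor_guidingCenter_le hD hε.le ht, hV, norm_smul,
    L.le_of_opNorm_le_of_le (hD.norm_le _ ht) (hE.norm_le _ ht),
    Real.norm_of_nonneg (by positivity)]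

theorem norm_driftDefect_le_of_isLipschitzDeriv (h : IsScheme E ε Δt x₀ v₀ xn vn)
    (hE : IsLipschitzField E M K) (hD : IsLipschitzDeriv E D K Q) (hε : 0 < ε) (hΔ : 0 < Δt)
    (hV : ∀ k ≤ n, ‖vn k‖ ≤ V) :
    ‖driftDefect E Δt (fun k => guidingCenter ε (xn k) (vn k)) n‖ ≤
      n * Δt * (Q * (ε * V) ^ 2 + ε ^ 2 * (K * M)) +
        (2 * K + n * Δt * (Q * (1 + M))) * ((ε ^ 3 + Δt * ε) * V) := by
  refine norm_driftDefect_le_of_oscillation hD hΔ.le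
    (u := fun k => ε ^ 3 • vn k + (Δt * ε) • perp (vn k))
    (fun k _ => h.norm_guidingCenter_sub_le hE hε hΔ k) (fun k hk => ?_)
    fun k hk => h.norm_guidingCenter_expansion_le hE hD hε hΔ (hV k hk.le)
  grw [norm_add_le, norm_smul, norm_smul_perp (by positivity), hV k hk,
    Real.norm_of_nonneg (by positivity), ← add_mul]

end IsScheme

namespace IsTrajectory

theorem norm_guidingCenter_sub_le (h : IsTrajectory E ε x₀ v₀ x v) (hE : IsLipschitzField E M K)
    (hε : 0 < ε) (ha : 0 ≤ a) (hab : a ≤ b) :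
    ‖guidingCenter ε (x b) (v b) - guidingCenter ε (x a) (v a)‖ ≤ M * (b - a) :=
  norm_sub_le_of_hasDerivWithinAt_Ici ha hab
    (fun _ ht => h.hasDerivWithinAt_guidingCenter hε ht) fun t ht => by
      rw [norm_neg, norm_perp]
      exact hE.norm_le _ (ha.trans ht.1)

theorem norm_field_guidingCenter_sub_le (h : IsTrajectory E ε x₀ v₀ x v)
    (hE : IsLipschitzField E M K) (hε : 0 < ε) (ha : 0 ≤ a) (hab : a ≤ b) :
    ‖E (b, guidingCenter ε (x b) (v b)) - E (a, guidingCenter ε (x a) (v a))‖ ≤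
      M * (1 + K) * (b - a) := by
  have hK := hE.space_nonneg
  grw [hE.norm_sub_le _ _ ha (ha.trans hab), h.norm_guidingCenter_sub_le hE hε ha hab,
    abs_of_nonneg (sub_nonneg.2 hab)]
  exact (by ring : _ = _).le

theorem norm_driftDefect_le (h : IsTrajectory E ε x₀ v₀ x v) (hE : IsLipschitzField E M K)
    (hε : 0 < ε) (hΔ : 0 < Δt) (hV : ∀ s ∈ Icc 0 (n * Δt), ‖v s‖ ≤ V) :
    ‖driftDefect E Δt (fun k => guidingCenter ε (x (k * Δt)) (v (k * Δt))) n‖ ≤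
      n * Δt * (K * (ε * V) + M * (1 + K) * Δt) := by
  have hM := hE.bound_nonneg
  have hK := hE.space_nonneg
  refine Particle.norm_driftDefect_le fun k hk => ?_
  have ha : 0 ≤ k * Δt := by positivity
  have hbn : ((k + 1 : ℕ) : ℝ) * Δt ≤ n * Δt :=
    mul_le_mul_of_nonneg_right (by exact_mod_cast hk) hΔ.le
  have hba := cast_succ_mul_sub k Δt
  have hstep := h.norm_guidingCenter_step_le (a := k * Δt) (b := (k + 1 : ℕ) * Δt)
    (e := E (k * Δt, guidingCenter ε (x (k * Δt)) (v (k * Δt))))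
    (C := K * (ε * V) + M * (1 + K) * Δt) hε ha (by linarith) fun s hs => by
      have hs₀ := ha.trans hs.1
      grw [norm_sub_le_norm_sub_add_norm_sub _ (E (s, guidingCenter ε (x s) (v s))),
        norm_field_sub_guidingCenter_le hE hε.le hs₀, hV s ⟨hs₀, hs.2.trans hbn⟩,
        h.norm_field_guidingCenter_sub_le hE hε ha hs.1, hs.2, hba]
  rw [hba] at hstep
  exact hstep.trans_eq (mul_comm _ _)

theorem hasDerivWithinAt_guidingCenter_sub_oscillation (h : IsTrajectory E ε x₀ v₀ x v)
    (hε : 0 < ε) (L : Plane →L[ℝ] Plane) (e : Plane) {t : ℝ} (ht : 0 ≤ t) :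
    HasDerivWithinAt
      (fun s => guidingCenter ε (x s) (v s) + s • perp e - perp (L (ε ^ 3 • v s)))
      (-perp ((E (t, x t) - e - L (ε • perp (v t))) + ε ^ 2 • L (E (t, x t)))) (Ici 0) t := by
  refine (((h.hasDerivWithinAt_guidingCenter hε ht).fun_add
    ((hasDerivWithinAt_id t _).smul_const (perp e))).fun_sub (hasDerivWithinAt_perp
      (L.hasFDerivAt.comp_hasDerivWithinAt t ((h.deriv_v t ht).const_smul (ε ^ 3))))).congr_deriv ?_
  have hv : ε ^ 3 • ε⁻¹ • (E (t, x t) - ε⁻¹ • perp (v t)) =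
      ε ^ 2 • E (t, x t) - ε • perp (v t) := by
    match_scalars <;> field_simp
  rw [hv, map_sub, map_smul]
  simp only [perp_add, perp_sub, perp_smul]
  module

theorem norm_field_sub_linearization_le (h : IsTrajectory E ε x₀ v₀ x v)
    (hE : IsLipschitzField E M K) (hD : IsLipschitzDeriv E D K Q) (hε : 0 < ε) (ha : 0 ≤ a)
    (hab : a ≤ b) (hV : ‖v b‖ ≤ V) :
    ‖E (b, x b) - E (a, guidingCenter ε (x a) (v a)) -
        D (a, guidingCenter ε (x a) (v a)) (ε • perp (v b))‖ ≤
      Q * (ε * V) ^ 2 + Q * ((1 + M) * (b - a)) * (ε * V) + M * (1 + K) * (b - a) := by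
  have := hE.bound_nonneg
  have hQ := hD.nonneg
  have hb := ha.trans hab
  set y := fun s => guidingCenter ε (x s) (v s)
  have hsplit : E (b, x b) - E (a, y a) - D (a, y a) (ε • perp (v b)) =
      (E (b, x b) - E (b, y b) - D (b, y b) (ε • perp (v b))) +
        (D (b, y b) - D (a, y a)) (ε • perp (v b)) + (E (b, y b) - E (a, y a)) := by
    rw [sub_apply]
    abel
  have hD' : ‖D (b, y b) - D (a, y a)‖ ≤ Q * ((1 + M) * (b - a)) := by
    grw [hD.norm_sub_le _ _ ha hb, h.norm_guidingCenter_sub_le hE hε ha hab,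
      abs_of_nonneg (sub_nonneg.2 hab)]
    exact (by ring : _ = _).le
  have hperp : ‖ε • perp (v b)‖ ≤ ε * V := by grw [norm_smul_perp hε.le, hV]
  rw [hsplit]
  grw [norm_add₃_le, norm_taylor_guidingCenter_le hD hε.le hb, hV,
    (D (b, y b) - D (a, y a)).le_of_opNorm_le_of_le hD' hperp,
    h.norm_field_guidingCenter_sub_le hE hε ha hab]

theorem norm_guidingCenter_expansion_le (h : IsTrajectory E ε x₀ v₀ x v)
    (hE : IsLipschitzField E M K) (hD : IsLipschitzDeriv E D K Q) (hε : 0 < ε) (ha : 0 ≤ a)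
    (hab : a ≤ b) (hV : ∀ s ∈ Icc a b, ‖v s‖ ≤ V) :
    ‖guidingCenter ε (x b) (v b) - guidingCenter ε (x a) (v a) +
        (b - a) • perp (E (a, guidingCenter ε (x a) (v a))) -
        perp (D (a, guidingCenter ε (x a) (v a)) (ε ^ 3 • v b - ε ^ 3 • v a))‖ ≤
      (Q * (ε * V) ^ 2 + Q * ((1 + M) * (b - a)) * (ε * V) + M * (1 + K) * (b - a) +
        ε ^ 2 * (K * M)) * (b - a) := by
  have hM := hE.bound_nonneg
  have hK := hE.space_nonneg
  have hQ := hD.nonneg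
  have hV₀ : 0 ≤ V := (norm_nonneg _).trans (hV a (left_mem_Icc.2 hab))
  set L := D (a, guidingCenter ε (x a) (v a))
  refine (congrArg norm ?_).trans_le (norm_sub_le_of_hasDerivWithinAt_Ici ha hab
    (fun t ht => h.hasDerivWithinAt_guidingCenter_sub_oscillation hε L
      (E (a, guidingCenter ε (x a) (v a))) ht) fun s hs => ?_)
  · rw [map_sub, perp_sub]
    module
  · rw [norm_neg, norm_perp]
    grw [norm_add_le, h.norm_field_sub_linearization_le hE hD hε ha hs.1 (hV s hs), norm_smul,
      L.le_of_opNorm_le_of_le (hD.norm_le _ ha) (hE.norm_le _ (ha.trans hs.1)),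
      Real.norm_of_nonneg (by positivity), hs.2]

theorem norm_driftDefect_le_of_isLipschitzDeriv (h : IsTrajectory E ε x₀ v₀ x v)
    (hE : IsLipschitzField E M K) (hD : IsLipschitzDeriv E D K Q) (hε : 0 < ε) (hΔ : 0 < Δt)
    (hV : ∀ s ∈ Icc 0 (n * Δt), ‖v s‖ ≤ V) :
    ‖driftDefect E Δt (fun k => guidingCenter ε (x (k * Δt)) (v (k * Δt))) n‖ ≤
      n * Δt * (Q * (ε * V) ^ 2 + Q * ((1 + M) * Δt) * (ε * V) + M * (1 + K) * Δt +
        ε ^ 2 * (K * M)) + (2 * K + n * Δt * (Q * (1 + M))) * (ε ^ 3 * V) := by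
  have hk₀ (k : ℕ) : 0 ≤ k * Δt := by positivity
  have hkn {k : ℕ} (hk : k ≤ n) : k * Δt ≤ n * Δt := by gcongr
  have hab (k : ℕ) : k * Δt ≤ (k + 1 : ℕ) * Δt := by gcongr; omega
  refine norm_driftDefect_le_of_oscillation hD hΔ.le (u := fun k => ε ^ 3 • v (k * Δt))
    (fun k _ => ?_) (fun k hk => ?_) fun k hk => ?_
  · have hstep := h.norm_guidingCenter_sub_le hE hε (hk₀ k) (hab k)
    rwa [cast_succ_mul_sub] at hstep
  · grw [norm_smul, hV _ ⟨hk₀ k, hkn hk⟩, Real.norm_of_nonneg (by positivity)]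
  · have hstep := h.norm_guidingCenter_expansion_le hE hD hε (hk₀ k) (hab k)
      fun s hs => hV s ⟨(hk₀ k).trans hs.1, hs.2.trans (hkn hk)⟩
    rw [cast_succ_mul_sub] at hstep
    exact hstep.trans_eq (mul_comm _ _)

end IsTrajectory

theorem norm_guidingCenter_sub_le_of_norm_driftDefect_le (hE : IsLipschitzField E M K)
    (hΔ : 0 ≤ Δt) (ht : IsTrajectory E ε x₀ v₀ x v) (hs : IsScheme E ε Δt x₀ v₀ xn vn)
    (hA : 0 ≤ A) (hv : ∀ s ∈ Icc 0 (N * Δt), ‖v s‖ ≤ A * Real.exp (K * s))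
    (hvn : ∀ n ≤ N, ‖vn n‖ ≤ A * Real.exp (K * (n * Δt))) (hB : 0 ≤ B)
    (hdefect : ∀ n ≤ N, ∀ r, 1 ≤ r → (∀ s ∈ Icc 0 (n * Δt), ‖v s‖ ≤ A * r) →
      (∀ k ≤ n, ‖vn k‖ ≤ A * r) →
      ‖driftDefect E Δt (fun k => guidingCenter ε (xn k) (vn k)) n‖ +
        ‖driftDefect E Δt (fun k => guidingCenter ε (x (k * Δt)) (v (k * Δt))) n‖ ≤ B * r ^ 2) :
    ‖guidingCenter ε (xn N) (vn N) - guidingCenter ε (x (N * Δt)) (v (N * Δt))‖ ≤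
      2 * B * Real.exp (2 * K * (N * Δt)) := by
  have hK := hE.space_nonneg
  refine norm_sub_le_of_norm_driftDefect_le (y := fun k => guidingCenter ε (xn k) (vn k))
    (z := fun k => guidingCenter ε (x (k * Δt)) (v (k * Δt))) hE hΔ hB
    (by simp [ht.init_x, ht.init_v, hs.init_x, hs.init_v]) fun n hn => ?_
  have hsq : Real.exp (2 * K * (n * Δt)) = Real.exp (K * (n * Δt)) ^ 2 := by
    rw [← Real.exp_nat_mul]
    ring_nf
  rw [hsq]
  refine hdefect n hn _ (Real.one_le_exp (by positivity)) (fun s hs => ?_) fun k hk => ?_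
  · refine (hv s ⟨hs.1, hs.2.trans (by gcongr)⟩).trans ?_
    gcongr
    exact hs.2
  · exact (hvn k (hk.trans hn)).trans (by gcongr)

theorem norm_guidingCenter_sub_le_of_isLipschitzField (hE : IsLipschitzField E M K) (hε : 0 < ε)
    (hΔ : 0 < Δt) (ht : IsTrajectory E ε x₀ v₀ x v) (hs : IsScheme E ε Δt x₀ v₀ xn vn)
    (hA : 0 ≤ A) (hv : ∀ s ∈ Icc 0 (N * Δt), ‖v s‖ ≤ A * Real.exp (K * s))
    (hvn : ∀ n ≤ N, ‖vn n‖ ≤ A * Real.exp (K * (n * Δt))) :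
    ‖guidingCenter ε (xn N) (vn N) - guidingCenter ε (x (N * Δt)) (v (N * Δt))‖ ≤
      2 * (N * Δt * (M * (1 + K) * Δt + 2 * K * (ε * A))) * Real.exp (2 * K * (N * Δt)) := by
  have hM := hE.bound_nonneg
  have hK := hE.space_nonneg
  refine norm_guidingCenter_sub_le_of_norm_driftDefect_le hE hΔ.le ht hs hA hv hvn (by positivity)
    fun n hn r hr hV hVn => ?_
  have hnN : n * Δt ≤ N * Δt := by gcongr
  grw [hs.norm_driftDefect_le hE hε hΔ hVn, ht.norm_driftDefect_le hE hε hΔ hV, hnN]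
  have hr₁ := sub_nonneg.2 (one_le_pow₀ hr (n := 2))
  have hr₂ := sub_nonneg.2 (le_self_pow₀ hr two_ne_zero)
  have : 0 ≤ N * Δt * (M * (1 + K) * Δt * (r ^ 2 - 1) + 2 * K * (ε * A) * (r ^ 2 - r)) := by
    positivity
  linear_combination this

theorem norm_guidingCenter_sub_le_of_isLipschitzDeriv (hE : IsLipschitzField E M K)
    (hD : IsLipschitzDeriv E D K Q) (hε : 0 < ε) (hΔ : 0 < Δt)
    (ht : IsTrajectory E ε x₀ v₀ x v) (hs : IsScheme E ε Δt x₀ v₀ xn vn) (hA : 0 ≤ A)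
    (hv : ∀ s ∈ Icc 0 (N * Δt), ‖v s‖ ≤ A * Real.exp (K * s))
    (hvn : ∀ n ≤ N, ‖vn n‖ ≤ A * Real.exp (K * (n * Δt))) :
    ‖guidingCenter ε (xn N) (vn N) - guidingCenter ε (x (N * Δt)) (v (N * Δt))‖ ≤
      2 * (N * Δt * (2 * Q * (ε * A) ^ 2 + Q * ((1 + M) * Δt) * (ε * A) + M * (1 + K) * Δt +
        2 * ε ^ 2 * (K * M)) +
        (2 * K + N * Δt * (Q * (1 + M))) * ((2 * ε ^ 2 + Δt) * (ε * A))) *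
        Real.exp (2 * K * (N * Δt)) := by
  have hM := hE.bound_nonneg
  have hK := hE.space_nonneg
  have hQ := hD.nonneg
  refine norm_guidingCenter_sub_le_of_norm_driftDefect_le hE hΔ.le ht hs hA hv hvn (by positivity)
    fun n hn r hr hV hVn => ?_
  have hnN : n * Δt ≤ N * Δt := by gcongr
  grw [hs.norm_driftDefect_le_of_isLipschitzDeriv hE hD hε hΔ hVn,
    ht.norm_driftDefect_le_of_isLipschitzDeriv hE hD hε hΔ hV, hnN]
  have hr₁ := sub_nonneg.2 (one_le_pow₀ hr (n := 2))
  have hr₂ := sub_nonneg.2 (le_self_pow₀ hr two_ne_zero)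
  have : 0 ≤ N * Δt * (M * (1 + K) * Δt + 2 * ε ^ 2 * (K * M)) * (r ^ 2 - 1) +
      (N * Δt * (Q * ((1 + M) * Δt)) +
        (2 * K + N * Δt * (Q * (1 + M))) * (2 * ε ^ 2 + Δt)) * (ε * A) * (r ^ 2 - r) := by
    positivity
  linear_combination this

end GuidingCenterError

section ErrorEstimates

variable {E : ℝ × Plane → Plane} {D : ℝ × Plane → Plane →L[ℝ] Plane} {M K Q ε Δt T : ℝ}
  {x₀ v₀ : Plane} {x v : ℝ → Plane} {xn vn : ℕ → Plane} {N : ℕ}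

theorem velocityConst_nonneg (hM : 0 ≤ M) (hK : 0 ≤ K) : 0 ≤ velocityConst M K := by
  unfold velocityConst
  positivity

theorem velocityBound_nonneg (hM : 0 ≤ M) (hK : 0 ≤ K) (hε : 0 ≤ ε) (hT : 0 ≤ T) :
    0 ≤ velocityBound M K ε v₀ T := by
  have hc := velocityConst_nonneg hM hK
  unfold velocityBound
  positivity

theorem velocityBound_mono (hM : 0 ≤ M) (hK : 0 ≤ K) (hε : 0 ≤ ε) :
    Monotone (velocityBound M K ε v₀) := fun s t hst => by
  have hc := velocityConst_nonneg hM hK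
  unfold velocityBound
  gcongr

theorem IsTrajectory.norm_velocity_le_of_le (h : IsTrajectory E ε x₀ v₀ x v)
    (hE : IsLipschitzField E M K) (hε : 0 < ε) {t : ℝ} (ht : 0 ≤ t) (htT : t ≤ T) :
    ‖v t‖ ≤ velocityBound M K ε v₀ T * Real.exp (K * t) := by
  grw [h.norm_velocity_le hE hε ht, velocityBound_mono hE.bound_nonneg hE.space_nonneg hε.le htT]

theorem IsScheme.norm_velocity_le_of_le (h : IsScheme E ε Δt x₀ v₀ xn vn)
    (hE : IsLipschitzField E M K) (hε : 0 < ε) (hΔ : 0 < Δt) {n : ℕ} (hnN : n ≤ N) :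
    ‖vn n‖ ≤ velocityBound M K ε v₀ (N * Δt) * Real.exp (K * (n * Δt)) := by
  have hle : n * Δt ≤ N * Δt := by gcongr
  grw [h.norm_velocity_le hE hε hΔ n,
    velocityBound_mono hE.bound_nonneg hE.space_nonneg hε.le hle]

theorem mul_one_add_le (t : ℝ) : t * (1 + t) ≤ 2 * (1 + t ^ 2) := by
  nlinarith [sq_nonneg (t - 1)]

theorem one_add_sq_le (t : ℝ) : (1 + t) ^ 2 ≤ 2 * (1 + t ^ 2) := by
  nlinarith [sq_nonneg (t - 1)]

theorem one_add_pow_four_le (t : ℝ) : (1 + t) ^ 4 ≤ 8 * (1 + t ^ 4) := by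
  calc (1 + t) ^ 4 = ((1 + t) ^ 2) ^ 2 := by ring
    _ ≤ (2 * (1 + t ^ 2)) ^ 2 := by grw [one_add_sq_le]
    _ = 4 * (1 + t ^ 2) ^ 2 := by ring
    _ ≤ 4 * (2 * (1 + (t ^ 2) ^ 2)) := by grw [one_add_sq_le (t ^ 2)]
    _ = 8 * (1 + t ^ 4) := by ring

theorem le_add_mul_min {a b r s P X : ℝ} (hr : 0 ≤ r) (hs : 0 ≤ s) (hP : 0 ≤ P) (ha : 0 ≤ a)
    (hb : 0 ≤ b) (hXa : X ≤ r * (P * a)) (hXb : X ≤ s * (P * b)) :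
    X ≤ (r + s) * (P * min a b) := by
  rcases min_choice a b with h | h <;> rw [h, add_mul]
  · exact hXa.trans (le_add_of_nonneg_right (by positivity))
  · exact hXb.trans (le_add_of_nonneg_left (by positivity))

/-- The constant of the error bound that is of order `Δt` for fixed `ε`. -/
def classicalConst (M K : ℝ) : ℝ :=
  2 * M + 2 * K * velocityConst M K + M + velocityConst M K

theorem classicalConst_nonneg (hM : 0 ≤ M) (hK : 0 ≤ K) : 0 ≤ classicalConst M K := by
  have hc := velocityConst_nonneg hM hK
  unfold classicalConst
  positivity

theorem consistency_velocityBound_le (hM : 0 ≤ M) (hK : 0 ≤ K) (hε : 0 < ε) (hT : 0 ≤ T) :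
    2 * M + 2 * K * velocityBound M K ε v₀ T / ε + M / ε ^ 2 + velocityBound M K ε v₀ T / ε ^ 3 ≤
      classicalConst M K * ((1 + T) * ((1 + ‖v₀‖ + ε) * (1 + ε ^ 2))) / ε ^ 3 := by
  have hc := velocityConst_nonneg hM hK
  rw [le_div_iff₀ (by positivity)]
  set B := velocityBound M K ε v₀ T
  have hB : B ≤ velocityConst M K * ((1 + T) * (1 + ‖v₀‖ + ε)) := by
    simp only [B, velocityBound, mul_assoc]
    gcongr
    linarith
  have hP : ε ≤ 1 + ‖v₀‖ + ε := by linarith [norm_nonneg v₀]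
  have hW : ε ^ 2 ≤ 1 + ε ^ 2 := by linarith
  have hW' : 1 ≤ 1 + ε ^ 2 := by linarith [sq_nonneg ε]
  have hT' : 1 ≤ 1 + T := by linarith
  calc
    _ = 2 * M * (1 * (ε * ε ^ 2)) + 2 * K * (B * ε ^ 2) + M * (1 * (ε * 1)) + B * 1 := by
      field_simp
    _ ≤ 2 * M * ((1 + T) * ((1 + ‖v₀‖ + ε) * (1 + ε ^ 2))) +
        2 * K * (velocityConst M K * ((1 + T) * (1 + ‖v₀‖ + ε)) * (1 + ε ^ 2)) +
        M * ((1 + T) * ((1 + ‖v₀‖ + ε) * (1 + ε ^ 2))) +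
        velocityConst M K * ((1 + T) * (1 + ‖v₀‖ + ε)) * (1 + ε ^ 2) := by gcongr
    _ = _ := by rw [classicalConst]; ring

theorem phaseDist_le_classical (hE : IsLipschitzField E M K) (hε : 0 < ε) (hΔ : 0 < Δt)
    (ht : IsTrajectory E ε x₀ v₀ x v) (hs : IsScheme E ε Δt x₀ v₀ xn vn) (hT : N * Δt = T) :
    phaseDist ε (xn N) (vn N) (x T) (v T) ≤
      classicalConst M K * (T * (1 + T) * Real.exp (2 * K * T) *
        ((1 + ‖v₀‖ + ε) * (1 + ε ^ 2)) * (Δt / ε ^ 3)) := by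
  subst hT
  grw [phaseDist_le hE hε hΔ ht hs fun s hs => ht.norm_velocity_le_of_le hE hε hs.1 hs.2,
    consistency_velocityBound_le hE.bound_nonneg hE.space_nonneg hε (by positivity)]
  exact (by ring : _ = _).le

theorem norm_sub_le_asymptotic (hE : IsLipschitzField E M K) (hε : 0 < ε) (hΔ : 0 < Δt)
    (ht : IsTrajectory E ε x₀ v₀ x v) (hs : IsScheme E ε Δt x₀ v₀ xn vn) (hT : N * Δt = T) :
    ‖xn N - x T‖ ≤ 2 * (M * (1 + K) + (2 * K + 1) * velocityConst M K) *
      ((1 + T) ^ 2 * Real.exp (2 * K * T) * (1 + ‖v₀‖ + ε) * (Δt + ε)) := by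
  have hM := hE.bound_nonneg
  have hK := hE.space_nonneg
  have hc := velocityConst_nonneg hM hK
  have hT₀ : 0 ≤ T := hT ▸ by positivity
  have hdrift := norm_guidingCenter_sub_le_of_isLipschitzField hE hε hΔ ht hs
    (velocityBound_nonneg (v₀ := v₀) hM hK hε.le (by positivity))
    (fun s hs => ht.norm_velocity_le_of_le hE hε hs.1 hs.2)
    (fun n hn => hs.norm_velocity_le_of_le hE hε hΔ hn)
  have hv := ht.norm_velocity_le hE hε hT₀
  have hvn := hs.norm_velocity_le hE hε hΔ N
  rw [hT] at hdrift hvn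
  have hB₀ := velocityBound_nonneg (v₀ := v₀) hM hK hε.le hT₀
  set B := velocityBound M K ε v₀ T
  set X := Real.exp (2 * K * T)
  set P := 1 + ‖v₀‖ + ε
  have hX : Real.exp (K * T) ≤ X := Real.exp_le_exp.2 (by linarith [mul_nonneg hK hT₀])
  have hvel : ‖vn N - v T‖ ≤ 2 * (B * X) := by grw [norm_sub_le, hvn, hv, hX, two_mul]
  have hP : 1 ≤ P := by linarith [norm_nonneg v₀]
  have hB : B ≤ velocityConst M K * ((1 + T) * P) := by
    simp only [B, velocityBound, mul_assoc]
    gcongr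
    linarith
  have hT₁ : 1 ≤ 1 + T := by linarith
  have hT₂ : T ≤ 1 + T := by linarith
  have hΔ' : Δt ≤ Δt + ε := by linarith
  have hε' : ε ≤ Δt + ε := by linarith
  calc
    _ ≤ 2 * (T * (M * (1 + K) * Δt + 2 * K * (ε * B))) * X + ε * (2 * (B * X)) := by
      grw [norm_sub_le_phaseDist hε.le (xn N) (vn N) (x T) (v T), phaseDist, hdrift, hvel]
    _ = 2 * (M * (1 + K) * (T * (1 * 1) * Δt) + 2 * K * (T * B * ε) + 1 * B * ε) * X := by ring
    _ ≤ 2 * (M * (1 + K) * ((1 + T) * ((1 + T) * P) * (Δt + ε)) +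
        2 * K * ((1 + T) * (velocityConst M K * ((1 + T) * P)) * (Δt + ε)) +
        (1 + T) * (velocityConst M K * ((1 + T) * P)) * (Δt + ε)) * X := by gcongr
    _ = _ := by ring

theorem exists_position_error (hE : IsLipschitzField E M K) :
    ∃ C : ℝ, ∀ ε Δt : ℝ, 0 < ε → 0 < Δt → ∀ x₀ v₀ : Plane,
      ∀ x v : ℝ → Plane, IsTrajectory E ε x₀ v₀ x v →
      ∀ xn vn : ℕ → Plane, IsScheme E ε Δt x₀ v₀ xn vn →
      ∀ n : ℕ, ‖xn n - x (n * Δt)‖ ≤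
        C * ((1 + (n * Δt) ^ 2) * Real.exp (2 * K * (n * Δt)) * (1 + ‖v₀‖ + ε) *
          min (Δt / ε ^ 3 * (1 + ε ^ 2)) (Δt + ε)) := by
  have hM := hE.bound_nonneg
  have hK := hE.space_nonneg
  have hc := velocityConst_nonneg hM hK
  have hC := classicalConst_nonneg hM hK
  refine ⟨classicalConst M K * 2 + 2 * (M * (1 + K) + (2 * K + 1) * velocityConst M K) * 2,
    fun ε Δt hε hΔ x₀ v₀ x v ht xn vn hs n => ?_⟩
  have : 0 ≤ n * Δt := by positivity
  refine le_add_mul_min (by positivity) (by positivity) (by positivity) (by positivity)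
    (by positivity) ?_ ?_
  · grw [norm_sub_le_phaseDist hε.le (xn n) (vn n) _ (v (n * Δt)),
      phaseDist_le_classical hE hε hΔ ht hs rfl, mul_one_add_le]
    exact (by ring : _ = _).le
  · grw [norm_sub_le_asymptotic hE hε hΔ ht hs rfl, one_add_sq_le]
    exact (by ring : _ = _).le

theorem add_mul_add_le (r : ℝ) (hε : 0 ≤ ε) :
    (1 + r + ε) * (1 + ε ^ 2) ≤ 2 * ((1 + r ^ 2 + ε ^ 2) * (1 + ε)) := by
  have h₁ : r ≤ 1 + r ^ 2 := by nlinarith [sq_nonneg (r - 1)]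
  have h₂ : r * ε ^ 2 ≤ (r ^ 2 + ε ^ 2) * ε := by
    have := mul_nonneg hε (sq_nonneg (r - ε))
    have : 0 ≤ ε * (r ^ 2 + ε ^ 2) := by positivity
    nlinarith
  have : 0 ≤ r ^ 2 * (1 + ε) + ε ^ 2 + ε := by positivity
  linear_combination h₁ + h₂ + this

theorem mul_velocityBound_le (hM : 0 ≤ M) (hK : 0 ≤ K) (hT : 0 ≤ T) :
    ε * velocityBound M K ε v₀ T ≤ 2 * velocityConst M K * ((1 + T) * (1 + ‖v₀‖ ^ 2 + ε ^ 2)) := by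
  have hc := velocityConst_nonneg hM hK
  have hP : ε * (‖v₀‖ + ε) ≤ 2 * (1 + ‖v₀‖ ^ 2 + ε ^ 2) := by
    nlinarith [sq_nonneg (‖v₀‖ - ε), sq_nonneg ‖v₀‖, sq_nonneg ε]
  calc
    _ = velocityConst M K * ((1 + T) * (ε * (‖v₀‖ + ε))) := by rw [velocityBound]; ring
    _ ≤ velocityConst M K * ((1 + T) * (2 * (1 + ‖v₀‖ ^ 2 + ε ^ 2))) := by gcongr
    _ = _ := by ring

theorem velocityBound_sq_le :
    velocityBound M K ε v₀ T ^ 2 ≤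
      2 * velocityConst M K ^ 2 * ((1 + T) ^ 2 * (1 + ‖v₀‖ ^ 2 + ε ^ 2)) := by
  have hP : (‖v₀‖ + ε) ^ 2 ≤ 2 * (1 + ‖v₀‖ ^ 2 + ε ^ 2) := by
    linarith [add_sq_le (a := ‖v₀‖) (b := ε)]
  calc
    _ = velocityConst M K ^ 2 * ((1 + T) ^ 2 * (‖v₀‖ + ε) ^ 2) := by rw [velocityBound]; ring
    _ ≤ velocityConst M K ^ 2 * ((1 + T) ^ 2 * (2 * (1 + ‖v₀‖ ^ 2 + ε ^ 2))) := by gcongr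
    _ = _ := by ring

/-- The constant of the error bound for the guiding center that is uniform as `ε → 0`. -/
def asymptoticConst (M K Q : ℝ) : ℝ :=
  2 * (4 * Q * velocityConst M K ^ 2 + 2 * (Q * (1 + M)) * velocityConst M K + M * (1 + K) +
    2 * (K * M) + 4 * (2 * K + Q * (1 + M)) * velocityConst M K)

theorem asymptoticConst_nonneg (hM : 0 ≤ M) (hK : 0 ≤ K) (hQ : 0 ≤ Q) :
    0 ≤ asymptoticConst M K Q := by
  have hc := velocityConst_nonneg hM hK
  unfold asymptoticConst
  positivity

theorem norm_guidingCenter_sub_le_asymptotic (hE : IsLipschitzField E M K)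
    (hD : IsLipschitzDeriv E D K Q) (hε : 0 < ε) (hΔ : 0 < Δt)
    (ht : IsTrajectory E ε x₀ v₀ x v) (hs : IsScheme E ε Δt x₀ v₀ xn vn) (hT : N * Δt = T) :
    ‖guidingCenter ε (xn N) (vn N) - guidingCenter ε (x T) (v T)‖ ≤ asymptoticConst M K Q *
      ((1 + T) ^ 4 * Real.exp (2 * K * T) * (1 + ‖v₀‖ ^ 2 + ε ^ 2) * (Δt + ε ^ 2)) := by
  have hM := hE.bound_nonneg
  have hK := hE.space_nonneg
  have hQ := hD.nonneg
  have hc := velocityConst_nonneg hM hK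
  have hT₀ : 0 ≤ T := hT ▸ by positivity
  have haveraged := norm_guidingCenter_sub_le_of_isLipschitzDeriv hE hD hε hΔ ht hs
    (velocityBound_nonneg (v₀ := v₀) hM hK hε.le (by positivity))
    (fun s hs => ht.norm_velocity_le_of_le hE hε hs.1 hs.2)
    (fun n hn => hs.norm_velocity_le_of_le hE hε hΔ hn)
  rw [hT] at haveraged
  have hεB := mul_velocityBound_le (ε := ε) (v₀ := v₀) hM hK hT₀
  have hB := velocityBound_sq_le (M := M) (K := K) (ε := ε) (v₀ := v₀) (T := T)
  have hB₀ := velocityBound_nonneg (v₀ := v₀) hM hK hε.le hT₀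
  set B := velocityBound M K ε v₀ T
  set P := 1 + ‖v₀‖ ^ 2 + ε ^ 2
  have hP : 1 ≤ P := by linarith [sq_nonneg ‖v₀‖, sq_nonneg ε]
  have hT₁ : 1 ≤ 1 + T := by linarith
  have hT₂ : T ≤ 1 + T := by linarith
  have hΔ' : Δt ≤ Δt + ε ^ 2 := by linarith [sq_nonneg ε]
  have hε' : ε ^ 2 ≤ Δt + ε ^ 2 := by linarith
  have hΔε : 2 * ε ^ 2 + Δt ≤ 2 * (Δt + ε ^ 2) := by linarith
  refine haveraged.trans ?_
  set X := Real.exp (2 * K * T)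
  calc
    _ = 2 * (2 * Q * (T * 1 * B ^ 2 * ε ^ 2) + Q * (1 + M) * (T * 1 ^ 2 * (ε * B) * Δt) +
        M * (1 + K) * (T * 1 ^ 3 * 1 * Δt) + 2 * (K * M) * (T * 1 ^ 3 * 1 * ε ^ 2) +
        (2 * K * (1 * 1 ^ 2 * (ε * B)) + Q * (1 + M) * (T * 1 ^ 2 * (ε * B))) *
          (2 * ε ^ 2 + Δt)) * X := by ring
    _ ≤ 2 * (2 * Q * ((1 + T) * (1 + T) * (2 * velocityConst M K ^ 2 * ((1 + T) ^ 2 * P)) *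
          (Δt + ε ^ 2)) +
        Q * (1 + M) * ((1 + T) * (1 + T) ^ 2 * (2 * velocityConst M K * ((1 + T) * P)) *
          (Δt + ε ^ 2)) +
        M * (1 + K) * ((1 + T) * (1 + T) ^ 3 * P * (Δt + ε ^ 2)) +
        2 * (K * M) * ((1 + T) * (1 + T) ^ 3 * P * (Δt + ε ^ 2)) +
        (2 * K * ((1 + T) * (1 + T) ^ 2 * (2 * velocityConst M K * ((1 + T) * P))) +
          Q * (1 + M) * ((1 + T) * (1 + T) ^ 2 * (2 * velocityConst M K * ((1 + T) * P)))) *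
          (2 * (Δt + ε ^ 2))) * X := by gcongr
    _ = _ := by rw [asymptoticConst]; ring

theorem exists_guidingCenter_error (hE : IsLipschitzField E M K) (hD : IsLipschitzDeriv E D K Q) :
    ∃ C : ℝ, ∀ ε Δt : ℝ, 0 < ε → 0 < Δt → ∀ x₀ v₀ : Plane,
      ∀ x v : ℝ → Plane, IsTrajectory E ε x₀ v₀ x v →
      ∀ xn vn : ℕ → Plane, IsScheme E ε Δt x₀ v₀ xn vn →
      ∀ n : ℕ, ‖guidingCenter ε (xn n) (vn n) - guidingCenter ε (x (n * Δt)) (v (n * Δt))‖ ≤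
        C * ((1 + (n * Δt) ^ 4) * Real.exp (2 * K * (n * Δt)) * (1 + ‖v₀‖ ^ 2 + ε ^ 2) *
          min (Δt / ε ^ 3 * (1 + ε)) (Δt + ε ^ 2)) := by
  have hM := hE.bound_nonneg
  have hK := hE.space_nonneg
  have hC := classicalConst_nonneg hM hK
  have hC' := asymptoticConst_nonneg hM hK hD.nonneg
  refine ⟨classicalConst M K * 16 + asymptoticConst M K Q * 8,
    fun ε Δt hε hΔ x₀ v₀ x v ht xn vn hs n => ?_⟩
  have : 0 ≤ n * Δt := by positivity
  refine le_add_mul_min (by positivity) (by positivity) (by positivity) (by positivity)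
    (by positivity) ?_ ?_
  · have hpow : n * Δt * (1 + n * Δt) ≤ 8 * (1 + (n * Δt) ^ 4) := by
      nlinarith [mul_one_add_le (n * Δt), sq_nonneg ((n * Δt) ^ 2 - 1)]
    calc
      _ ≤ phaseDist ε (xn n) (vn n) (x (n * Δt)) (v (n * Δt)) :=
        le_add_of_nonneg_right (by positivity)
      _ ≤ _ := by
        grw [phaseDist_le_classical hE hε hΔ ht hs rfl, hpow, add_mul_add_le _ hε.le]
      _ = _ := by ring
  · grw [norm_guidingCenter_sub_le_asymptotic hE hD hε hΔ ht hs rfl, one_add_pow_four_le]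
    exact (by ring : _ = _).le

end ErrorEstimates

end Particle

end

theorem theorem3p1 :
    -- the scheme has a unique solution
    (∀ (E : ℝ × Particle.Plane → Particle.Plane) (ε Δt : ℝ), 0 < ε → 0 < Δt →
      ∀ x₀ v₀ : Particle.Plane,
        ∃! s : (ℕ → Particle.Plane) × (ℕ → Particle.Plane),
          Particle.IsScheme E ε Δt x₀ v₀ s.1 s.2) ∧
    -- (i) error in the space variable
    (∀ E : ℝ × Particle.Plane → Particle.Plane,
      ContinuousOn E (Set.Ici 0 ×ˢ Set.univ) →
      Sobolev.MemW1Inf Particle.spaceTime E →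
      ∃ C : ℝ, ∀ ε Δt : ℝ, 0 < ε → 0 < Δt → ∀ x₀ v₀ : Particle.Plane,
        ∀ x v : ℝ → Particle.Plane, Particle.IsTrajectory E ε x₀ v₀ x v →
        ∀ xn vn : ℕ → Particle.Plane, Particle.IsScheme E ε Δt x₀ v₀ xn vn →
        ∀ n : ℕ,
          ‖xn n - x (n * Δt)‖ ≤
            C * ((1 + (n * Δt) ^ 2) * Real.exp (2 * Particle.Kx E * (n * Δt)) *
              (1 + ‖v₀‖ + ε) *
              min (Δt / ε ^ 3 * (1 + ε ^ 2)) (Δt + ε))) ∧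
    -- (ii) error in the guiding-center variable
    (∀ E : ℝ × Particle.Plane → Particle.Plane,
      ContinuousOn E (Set.Ici 0 ×ˢ Set.univ) →
      Sobolev.MemW2Inf Particle.spaceTime E →
      ∃ C : ℝ, ∀ ε Δt : ℝ, 0 < ε → 0 < Δt → ∀ x₀ v₀ : Particle.Plane,
        ∀ x v : ℝ → Particle.Plane, Particle.IsTrajectory E ε x₀ v₀ x v →
        ∀ xn vn : ℕ → Particle.Plane, Particle.IsScheme E ε Δt x₀ v₀ xn vn →
        ∀ n : ℕ,
          ‖Particle.guidingCenter ε (xn n) (vn n) -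
              Particle.guidingCenter ε (x (n * Δt)) (v (n * Δt))‖ ≤
            C * ((1 + (n * Δt) ^ 4) * Real.exp (2 * Particle.Kx E * (n * Δt)) *
              (1 + ‖v₀‖ ^ 2 + ε ^ 2) *
              min (Δt / ε ^ 3 * (1 + ε)) (Δt + ε ^ 2))) := by
  refine ⟨fun E ε Δt hε hΔ x₀ v₀ => Particle.existsUnique_isScheme E hε hΔ x₀ v₀,
    fun E hc hW => ?_, fun E hc hW => ?_⟩
  · obtain ⟨M, hE⟩ := Particle.exists_isLipschitzField_of_memW1Inf hc hW
    exact Particle.exists_position_error hE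
  · obtain ⟨M, hE⟩ := Particle.exists_isLipschitzField_of_memW1Inf hc hW.memW1Inf
    obtain ⟨D, Q, hD⟩ := Particle.exists_isLipschitzDeriv_of_memW2Inf hc hW
    exact Particle.exists_guidingCenter_error hE hD
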